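/- **Setting.** Let $\mathcal Q=\{(u,v):1\le u\le v<\infty\}$, $\Gamma=\{u=v\}$, and let $\phi,r,m$ be real functions on $\mathcal Q$. Put $\lambda=\partial_v r$, $\nu=\partial_u r$, $\mu=2m/r$, $\Omega^2=-4\lambda\nu/(1-\mu)$. Derivatives of functions of bounded variation (BV) are represented by right-continuous functions, and differential equations are understood in integrated form along null lines $\{u=\mathrm{const}\}$, $\{v=\mathrm{const}\}$. The triple $(\phi,r,m)$ solves the spherically symmetric Einstein-scalar-field system if $r\ge 0$, $r=0$ exactly on $\Gamma$, $m=0$ on $\Gamma$ (with $m$ absolutely continuous up to $\Gamma$ along null lines), $v=2r(1,v)+1$ for $v\ge1$, $\Omega^2>0$ off $\Gamma$, and $$\partial_u\lambda=\partial_v\nu=\frac{\mu}{(1-\mu)r}\lambda\nu,\qquad 2\nu\,\partial_u m=(1-\mu)r^2(\partial_u\phi)^2,\qquad 2\lambda\,\partial_v m=(1-\mu)r^2(\partial_v\phi)^2,$$ $$\partial_u\partial_v(r\phi)=\partial_v\partial_u(r\phi)=\frac{\mu\lambda\nu}{(1-\mu)r}\phi .$$ It is a *BV solution* if, on each compact $\mathcal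 D(u_0,v_0)=\{u_0\le u\le v\le v_0\}\subset\mathcal Q$: $\sup(-\nu)<\infty$ and $\sup\lambda^{-1}<\infty$ (in particular $\lambda\neq 0$); $\lambda$ and $\partial_v(r\phi)$ are BV in $v$ uniformly in $u$, and $\nu$ and $\partial_u(r\phi)$ are BV in $u$ uniformly in $v$; $\phi$ is absolutely continuous in each variable with uniformly bounded total variation; and for each $(a,a)\in\Gamma$, $\lim_{\epsilon\to0+}(\lambda+\nu)(a,a+\epsilon)=\lim_{\epsilon\to0+}(\partial_v(r\phi)+\partial_u(r\phi))(a,a+\epsilon)=0$, and the suprema over $0<\delta\le\epsilon$ of the total variations of $\phi$ on $$\{a-\delta\}\times(a-\delta,a),\quad (a-\epsilon,a-\delta)\times\{a-\delta\},\quad (a,a+\delta)\times\{a+\delta\},\quad \{a+\delta\}\times(a+\delta,a+\epsilon)$$ tend to $0$ as $\epsilon\to0+$ (the first two for $a>1$ only). A BV solution is *locally BV scattering* if (1) $\int_u^\infty\Omega^2(u,v)\,dv=\infty$ for every $u\ge1$; (2) $M(u)=\lim_{v\to\infty}m(u,v)$ exists in $[-\infty,\infty]$ for every $u\ge 1$ and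 $M(u)\to0$ as $u\to\infty$; (3) for some $R>0$, the total variations of $\partial_v(r\phi)(u,\cdot)$ and of $\log\lambda(u,\cdot)$ on $\{v\ge u:r(u,v)\le R\}$ tend to $0$ as $u\to\infty$. Its initial data are *asymptotically flat of order $\omega>1$ in BV* if $\partial_v(r\phi)(1,\cdot)$ has finite total variation on $[1,\infty)$ and $\sup_{v\ge1}(1+r)^{\omega}|\partial_v(r\phi)|(1,v)<\infty$. **Theorem.** Let $1<\omega<3$ and let $(\phi,r,m)$ be a locally BV scattering solution whose initial data are asymptotically flat of order $\omega$ in BV. Suppose that there are $V\ge1$ and $L>0$ with $$r^{\omega}\,\partial_v(r\phi)(1,v)\ge L\qquad\text{for all }v\ge V.$$ Then there are constants $L_\omega>0$ and $U\ge1$ such that, for all $u\ge U$ and all $v>u$, $$\partial_v(r\phi)(u,v)\ge L_\omega\min\{r(u,v)^{-\omega},u^{-\omega}\},\qquad -\partial_u(r\phi)(u,v)\ge L_\omega u^{-\omega},$$ and moreover, on the axis, $\partial_v(r\phi)(u,u)\ge L_\omega u^{-\omega}$ for all $u\ge U$. -/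

import Mathlib

namespace SSESF

open Set Filter Topology MeasureTheory

noncomputable section

/-- `∂_v f`, as a right derivative.  If `f (u, ·)` is a primitive of a right-continuous function,
this is the right-continuous representative of the distributional derivative. -/
def dv (f : ℝ → ℝ → ℝ) (u v : ℝ) : ℝ := derivWithin (fun v' => f u v') (Ici v) v

/-- `∂_u f`, as a right derivative. -/
def du (f : ℝ → ℝ → ℝ) (u v : ℝ) : ℝ := derivWithin (fun u' => f u' v) (Ici u) u

/-- On the interval `s`, the function `F` is locally absolutely continuous with derivative `f`
almost everywhere: `f` is locally integrable and `F b - F a = ∫_a^b f`. -/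
def IsPrimitiveOn (F f : ℝ → ℝ) (s : Set ℝ) : Prop :=
  ∀ a ∈ s, ∀ b ∈ s, IntervalIntegrable f volume a b ∧ F b - F a = ∫ x in a..b, f x

/-- The mass ratio `μ = 2 m / r`. -/
def massRatio (r m : ℝ → ℝ → ℝ) (u v : ℝ) : ℝ := 2 * m u v / r u v

/-- The common right-hand side `μ λ ν / ((1 - μ) r)` of the two equations for `r`. -/
def potential (r m : ℝ → ℝ → ℝ) (u v : ℝ) : ℝ :=
  massRatio r m u v / ((1 - massRatio r m u v) * r u v) * dv r u v * du r u v

/-- `Ω² = - 4 λ ν / (1 - μ)`: the quotient metric is `- Ω² du dv`. -/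
def OmegaSq (r m : ℝ → ℝ → ℝ) (u v : ℝ) : ℝ :=
  -4 * dv r u v * du r u v / (1 - massRatio r m u v)

/-- `(φ, r, m)` solves the spherically symmetric Einstein-scalar-field system on
`𝒬 = {(u, v) : 1 ≤ u ≤ v < ∞}`, in the double null coordinates normalised by `v = 2 r + 1` on the
initial curve `{u = 1}` and by `{r = 0} = {u = v}` (the axis).  Only the values of the functions on
`𝒬` matter.  The differential equations are required in integrated form along every null line, and
derivatives in the `u` direction are only considered away from the axis. -/
structure IsSolution (φ r m : ℝ → ℝ → ℝ) : Prop where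
  r_nonneg : ∀ u v, 1 ≤ u → u ≤ v → 0 ≤ r u v
  r_eq_zero_iff : ∀ u v, 1 ≤ u → u ≤ v → (r u v = 0 ↔ u = v)
  r_init : ∀ v, 1 ≤ v → v = 2 * r 1 v + 1
  m_axis : ∀ a, 1 ≤ a → m a a = 0
  /- the metric is nondegenerate: `Ω > 0` -/
  omega_pos : ∀ u v, 1 ≤ u → u < v → 0 < OmegaSq r m u v
  /- `λ = ∂_v r`, `ν = ∂_u r`, `∂_v (r φ)`, `∂_u (r φ)` are derivatives of `r` and `r φ` -/
  r_dv : ∀ u, 1 ≤ u → IsPrimitiveOn (fun v => r u v) (fun v => dv r u v) (Ici u)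
  r_du : ∀ v, 1 ≤ v → IsPrimitiveOn (fun u => r u v) (fun u => du r u v) (Icc 1 v)
  rphi_dv : ∀ u, 1 ≤ u →
    IsPrimitiveOn (fun v => (r * φ) u v) (fun v => dv (r * φ) u v) (Ici u)
  rphi_du : ∀ v, 1 ≤ v →
    IsPrimitiveOn (fun u => (r * φ) u v) (fun u => du (r * φ) u v) (Icc 1 v)
  /- `∂_u λ = μ λ ν / ((1 - μ) r)` and `∂_v ν = μ λ ν / ((1 - μ) r)` -/
  eq_dr_u : ∀ v, 1 ≤ v →
    IsPrimitiveOn (fun u => dv r u v) (fun u => potential r m u v) (Ico 1 v)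
  eq_dr_v : ∀ u, 1 ≤ u →
    IsPrimitiveOn (fun v => du r u v) (fun v => potential r m u v) (Ioi u)
  /- `2 ν ∂_u m = (1 - μ) r² (∂_u φ)²` and `2 λ ∂_v m = (1 - μ) r² (∂_v φ)²`, up to the axis;
  here `λ ν ≠ 0` away from the axis by `omega_pos` -/
  eq_dm_u : ∀ v, 1 ≤ v → IsPrimitiveOn (fun u => m u v)
    (fun u => (1 - massRatio r m u v) * r u v ^ 2 * du φ u v ^ 2 / (2 * du r u v)) (Icc 1 v)
  eq_dm_v : ∀ u, 1 ≤ u → IsPrimitiveOn (fun v => m u v)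
    (fun v => (1 - massRatio r m u v) * r u v ^ 2 * dv φ u v ^ 2 / (2 * dv r u v)) (Ici u)
  /- `∂_u ∂_v (r φ) = ∂_v ∂_u (r φ) = μ λ ν / ((1 - μ) r) φ` -/
  eq_dphi_u : ∀ v, 1 ≤ v →
    IsPrimitiveOn (fun u => dv (r * φ) u v) (fun u => potential r m u v * φ u v) (Ico 1 v)
  eq_dphi_v : ∀ u, 1 ≤ u →
    IsPrimitiveOn (fun v => du (r * φ) u v) (fun v => potential r m u v * φ u v) (Ioi u)

/-- The function `g` is of bounded variation in `v` on `{u} × [u, v₀]`, uniformly in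
`u ∈ [u₀, v₀]`. -/
def UniformBVInV (g : ℝ → ℝ → ℝ) (u₀ v₀ : ℝ) : Prop :=
  ∃ T : NNReal, ∀ u ∈ Icc u₀ v₀, eVariationOn (fun v => g u v) (Icc u v₀) ≤ T

/-- The function `g` is of bounded variation in `u` on `[u₀, v) × {v}`, uniformly in
`v ∈ [u₀, v₀]`. -/
def UniformBVInU (g : ℝ → ℝ → ℝ) (u₀ v₀ : ℝ) : Prop :=
  ∃ T : NNReal, ∀ v ∈ Icc u₀ v₀, eVariationOn (fun u => g u v) (Ico u₀ v) ≤ T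

/-- Right-continuity in `v` on each `{u} × [u, ∞)`. -/
def RightContinuousInV (g : ℝ → ℝ → ℝ) : Prop :=
  ∀ u v, 1 ≤ u → u ≤ v → ContinuousWithinAt (fun v' => g u v') (Ici v) v

/-- Right-continuity in `u` on each `[1, v) × {v}`. -/
def RightContinuousInU (g : ℝ → ℝ → ℝ) : Prop :=
  ∀ u v, 1 ≤ u → u < v → ContinuousWithinAt (fun u' => g u' v) (Ici u) u

/-- Solutions of bounded variation on `𝒬`.  The compact domains of dependence are
`𝒟(u₀, v₀) = {(u, v) : u₀ ≤ u ≤ v ≤ v₀}`. -/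
structure IsBVSolution (φ r m : ℝ → ℝ → ℝ) : Prop extends IsSolution φ r m where
  /- BV functions are right-continuous by convention -/
  dvr_rightCont : RightContinuousInV (dv r)
  dur_rightCont : RightContinuousInU (du r)
  dvrphi_rightCont : RightContinuousInV (dv (r * φ))
  durphi_rightCont : RightContinuousInU (du (r * φ))
  /- `sup (-ν) < ∞` and `sup λ⁻¹ < ∞` -/
  sup_neg_nu : ∀ u₀ v₀, 1 ≤ u₀ → u₀ ≤ v₀ →
    ∃ C : ℝ, ∀ u v, u₀ ≤ u → u < v → v ≤ v₀ → -du r u v ≤ C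
  sup_inv_lambda : ∀ u₀ v₀, 1 ≤ u₀ → u₀ ≤ v₀ →
    ∃ C : ℝ, ∀ u v, u₀ ≤ u → u ≤ v → v ≤ v₀ → dv r u v ≠ 0 ∧ (dv r u v)⁻¹ ≤ C
  lambda_bv : ∀ u₀ v₀, 1 ≤ u₀ → u₀ ≤ v₀ → UniformBVInV (dv r) u₀ v₀
  nu_bv : ∀ u₀ v₀, 1 ≤ u₀ → u₀ ≤ v₀ → UniformBVInU (du r) u₀ v₀
  axis_r : ∀ a, 1 ≤ a →
    Tendsto (fun ε => du r a (a + ε) + dv r a (a + ε)) (𝓝[>] 0) (𝓝 0)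
  phi_ac_v : ∀ u v, 1 ≤ u → u ≤ v → AbsolutelyContinuousOnInterval (fun v' => φ u v') u v
  phi_ac_u : ∀ u v, 1 ≤ u → u ≤ v → AbsolutelyContinuousOnInterval (fun u' => φ u' v) u v
  phi_bv_v : ∀ u₀ v₀, 1 ≤ u₀ → u₀ ≤ v₀ → UniformBVInV φ u₀ v₀
  phi_bv_u : ∀ u₀ v₀, 1 ≤ u₀ → u₀ ≤ v₀ → UniformBVInU φ u₀ v₀
  /- total variation of `φ` near the axis; the two conditions to the past of `(a, a)` make sense
  only for `a > 1` -/
  axis_phi_past_v : ∀ a, 1 < a → Tendsto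
    (fun ε => ⨆ δ ∈ Ioc 0 ε, eVariationOn (fun v => φ (a - δ) v) (Ioo (a - δ) a))
    (𝓝[>] (0 : ℝ)) (𝓝 0)
  axis_phi_past_u : ∀ a, 1 < a → Tendsto
    (fun ε => ⨆ δ ∈ Ioc 0 ε, eVariationOn (fun u => φ u (a - δ)) (Ioo (a - ε) (a - δ)))
    (𝓝[>] (0 : ℝ)) (𝓝 0)
  axis_phi_future_u : ∀ a, 1 ≤ a → Tendsto
    (fun ε => ⨆ δ ∈ Ioc 0 ε, eVariationOn (fun u => φ u (a + δ)) (Ioo a (a + δ)))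
    (𝓝[>] (0 : ℝ)) (𝓝 0)
  axis_phi_future_v : ∀ a, 1 ≤ a → Tendsto
    (fun ε => ⨆ δ ∈ Ioc 0 ε, eVariationOn (fun v => φ (a + δ) v) (Ioo (a + δ) (a + ε)))
    (𝓝[>] (0 : ℝ)) (𝓝 0)
  dvrphi_bv : ∀ u₀ v₀, 1 ≤ u₀ → u₀ ≤ v₀ → UniformBVInV (dv (r * φ)) u₀ v₀
  durphi_bv : ∀ u₀ v₀, 1 ≤ u₀ → u₀ ≤ v₀ → UniformBVInU (du (r * φ)) u₀ v₀
  axis_rphi : ∀ a, 1 ≤ a →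
    Tendsto (fun ε => dv (r * φ) a (a + ε) + du (r * φ) a (a + ε)) (𝓝[>] 0) (𝓝 0)

/-- `M (u) = lim_{v → ∞} m (u, v)` (possibly infinite) is the Bondi mass. -/
def IsBondiMass (m : ℝ → ℝ → ℝ) (M : ℝ → EReal) : Prop :=
  ∀ u, 1 ≤ u → Tendsto (fun v => (m u v : EReal)) atTop (𝓝 (M u))

/-- Locally BV scattering solutions.  That every incoming null line ends on the axis is built into
`𝒬 = {1 ≤ u ≤ v}`. -/
structure IsLocallyBVScattering (φ r m : ℝ → ℝ → ℝ) : Prop extends IsBVSolution φ r m where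
  /- an affine parameter `s` along `{u} × [u, ∞)` satisfies `ds = Ω² dv`, and it is unbounded -/
  complete_outgoing : ∀ u, 1 ≤ u → ∫⁻ v in Ioi u, ENNReal.ofReal (OmegaSq r m u v) = ⊤
  final_bondi_mass : ∃ M : ℝ → EReal, IsBondiMass m M ∧ Tendsto M atTop (𝓝 0)
  scattering : ∃ R : ℝ, 0 < R ∧
    Tendsto (fun u => eVariationOn (fun v => dv (r * φ) u v) {v | u ≤ v ∧ r u v ≤ R})
      atTop (𝓝 0) ∧
    Tendsto (fun u => eVariationOn (fun v => Real.log (dv r u v)) {v | u ≤ v ∧ r u v ≤ R})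
      atTop (𝓝 0)

/-- Initial data asymptotically flat of order `ω'` in BV. -/
structure IsAsymptoticallyFlatBV (φ r : ℝ → ℝ → ℝ) (ω' : ℝ) : Prop where
  one_lt : 1 < ω'
  bv : eVariationOn (fun v => dv (r * φ) 1 v) (Ici 1) ≠ ⊤
  bound : ∃ I₁ : ℝ, 0 < I₁ ∧ ∀ v, 1 ≤ v → (1 + r 1 v) ^ ω' * |dv (r * φ) 1 v| ≤ I₁

end

end SSESF

/-! Write λ = `dv r`, ν = `du r`. Since `potential` equals both ∂_u λ and ∂_v ν, the wave equation
reads ∂_u ∂_v(rφ) = φ ∂_u λ and ∂_v ∂_u(rφ) = φ ∂_v ν. The potential is nonpositive, so λ decreases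
in u from its initial value 1/2 and -ν increases in v; hence ∂_v(rφ) changes along an incoming line
by at most sup|φ| times the drop of λ, and ∂_u(rφ) along an outgoing line by at most sup|φ| times
the growth of -ν.

Scattering makes both amounts small. The mass tends to 0 where r is bounded below, and the
variations of log λ and ∂_v(rφ) tend to 0 where r is bounded; this gives λ → 1/2 uniformly as v → ∞
(`eventually_half_sub_le`) and -ν(u,v) ≤ λ(u,u) + o(1) as u → ∞ (`eventually_neg_dur_sub_le`).

A bootstrap then gives |φ| ≤ B u^(1-ω) v⁻¹ (`exists_phi_decay`). On an incoming line at large v, the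
part u ≥ v/2 changes ∂_v(rφ) by o(1) v^(-ω) because λ hardly varies. The part u ≤ v/2 has potential
O(v⁻²), so it contributes v⁻³ ∫ u^(1-ω) du, which is o(v^(-ω)) exactly because ω < 3
(`eventually_abs_dvrphi_sub_le`). So the initial lower bound L v^(-ω) survives up to the axis with
L/2. On the axis ∂_u(rφ) = -∂_v(rφ) in the limit, and integration outwards, with |φ| ≤ B u^(-ω) and
the small growth of -ν, preserves L/4. -/

namespace SSESF

open Set Filter Topology MeasureTheory

/-! ### Calculus of primitives in integrated form -/

namespace IsPrimitiveOn

variable {F f G g : ℝ → ℝ} {s : Set ℝ} {a b : ℝ}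

theorem mono {t : Set ℝ} (h : IsPrimitiveOn F f s) (hst : t ⊆ s) : IsPrimitiveOn F f t :=
  fun a ha b hb => h a (hst ha) b (hst hb)

theorem sub_const_mul (h : IsPrimitiveOn F f s) (h' : IsPrimitiveOn G g s) (c : ℝ) :
    IsPrimitiveOn (fun x => F x - c * G x) (fun x => f x - c * g x) s := by
  intro a ha b hb
  have h1 := h a ha b hb
  have h2 := h' a ha b hb
  refine ⟨h1.1.sub (h2.1.const_mul c), ?_⟩
  rw [intervalIntegral.integral_sub h1.1 (h2.1.const_mul c), intervalIntegral.integral_const_mul,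
    ← h1.2, ← h2.2]
  ring

theorem rpow {p : ℝ} (hp : p ≠ -1) :
    IsPrimitiveOn (fun x => x ^ (p + 1) / (p + 1)) (fun x => x ^ p) (Ici 1) := by
  intro a ha b hb
  have h0 : (0 : ℝ) ∉ uIcc a b := by
    intro h
    have := h.1
    have : (1 : ℝ) ≤ min a b := le_min ha hb
    linarith
  refine ⟨intervalIntegral.intervalIntegrable_rpow (Or.inr h0), ?_⟩
  rw [integral_rpow (Or.inr ⟨hp, h0⟩)]
  ring

theorem continuousOn_Icc (h : IsPrimitiveOn F f s) (hs : s.OrdConnected) (ha : a ∈ s)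
    (hb : b ∈ s) : ContinuousOn F (Icc a b) := by
  rcases lt_or_ge b a with hab | hab
  · simp [Icc_eq_empty (not_le.2 hab)]
  have h1 : ContinuousOn (fun x => F a + ∫ t in a..x, f t) (Icc a b) := by
    have := intervalIntegral.continuousOn_primitive_interval' (h a ha b hb).1 left_mem_uIcc
    rw [uIcc_of_le hab] at this
    exact continuousOn_const.add this
  refine h1.congr fun x hx => ?_
  have := (h a ha x (hs.out ha hb hx)).2
  simp only
  linarith

theorem sub_le_of_le (h : IsPrimitiveOn F f s) (ha : a ∈ s) (hb : b ∈ s) (hab : a ≤ b)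
    (hg : IntervalIntegrable g volume a b) (hle : ∀ x ∈ Ioo a b, f x ≤ g x) :
    F b - F a ≤ ∫ x in a..b, g x := by
  rw [(h a ha b hb).2]
  exact intervalIntegral.integral_mono_on_of_le_Ioo hab (h a ha b hb).1 hg hle

theorem le_sub_of_le (h : IsPrimitiveOn F f s) (ha : a ∈ s) (hb : b ∈ s) (hab : a ≤ b)
    (hg : IntervalIntegrable g volume a b) (hle : ∀ x ∈ Ioo a b, g x ≤ f x) :
    ∫ x in a..b, g x ≤ F b - F a := by
  rw [(h a ha b hb).2]
  exact intervalIntegral.integral_mono_on_of_le_Ioo hab hg (h a ha b hb).1 hle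

theorem le_of_nonneg (h : IsPrimitiveOn F f s) (ha : a ∈ s) (hb : b ∈ s) (hab : a ≤ b)
    (hle : ∀ x ∈ Ioo a b, 0 ≤ f x) : F a ≤ F b := by
  have := h.le_sub_of_le ha hb hab (g := fun _ => 0) (by simp) hle
  simp at this
  exact this

theorem le_of_nonpos (h : IsPrimitiveOn F f s) (ha : a ∈ s) (hb : b ∈ s) (hab : a ≤ b)
    (hle : ∀ x ∈ Ioo a b, f x ≤ 0) : F b ≤ F a := by
  have := h.sub_le_of_le ha hb hab (g := fun _ => 0) (by simp) hle
  simp at this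
  exact this

/-- A bound of the increment of one primitive by that of another one. -/
theorem abs_sub_le (h : IsPrimitiveOn F f s) (h' : IsPrimitiveOn G g s) (ha : a ∈ s) (hb : b ∈ s)
    (hab : a ≤ b) {C : ℝ} (hle : ∀ x ∈ Ioo a b, |f x| ≤ C * g x) :
    |F b - F a| ≤ C * (G b - G a) := by
  have hi := (h' a ha b hb).1.const_mul C
  have e : C * (G b - G a) = ∫ x in a..b, C * g x := by
    rw [(h' a ha b hb).2, intervalIntegral.integral_const_mul]
  have h1 := h.sub_le_of_le ha hb hab hi fun x hx => (abs_le.1 (hle x hx)).2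
  have h2 := h.le_sub_of_le ha hb hab hi.neg fun x hx => (abs_le.1 (hle x hx)).1
  simp only [Pi.neg_apply, intervalIntegral.integral_neg] at h2
  rw [abs_le, e]
  exact ⟨h2, h1⟩

/-- Right-continuity upgrades the almost everywhere derivative to a right derivative at the point.
The fundamental theorem for right derivatives then applies to quotients, so jumps of BV derivatives
do no harm. -/
theorem hasDerivWithinAt (h : IsPrimitiveOn F f s) (hs : s.OrdConnected) (ha : a ∈ s)
    (hb : b ∈ s) (hab : a < b) (hc : ContinuousWithinAt f (Ici a) a) :
    HasDerivWithinAt F (f a) (Ici a) a := by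
  have hi := (h a ha b hb).1
  have hm : StronglyMeasurableAtFilter f (𝓝[>] a) := by
    refine ⟨Ioc a b, Ioc_mem_nhdsGT hab, ?_⟩
    exact hi.1.aestronglyMeasurable
  have h1 : HasDerivWithinAt (fun x => ∫ t in a..x, f t) (f a) (Ici a) a :=
    intervalIntegral.integral_hasDerivWithinAt_right (t := Ioi a) (by simp) hm
      (hc.mono Ioi_subset_Ici_self)
  have h2 := h1.const_add (F a)
  refine h2.congr_of_eventuallyEq ?_ (by simp)
  filter_upwards [Icc_mem_nhdsGE hab] with x hx
  have := (h a ha x (hs.out ha hb hx)).2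
  linarith

/-- The quotient rule in integrated form, for right-continuous derivatives. -/
theorem integral_div (hF : IsPrimitiveOn F f s) (hG : IsPrimitiveOn G g s) (hs : s.OrdConnected)
    (ha : a ∈ s) (hb : b ∈ s) (hab : a ≤ b) (h0 : ∀ x ∈ Icc a b, G x ≠ 0)
    (hf : ∀ x ∈ Ioo a b, ContinuousWithinAt f (Ici x) x)
    (hg : ∀ x ∈ Ioo a b, ContinuousWithinAt g (Ici x) x) :
    IntervalIntegrable (fun x => (f x * G x - F x * g x) / G x ^ 2) volume a b ∧
      ∫ x in a..b, (f x * G x - F x * g x) / G x ^ 2 = F b / G b - F a / G a := by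
  have cF := hF.continuousOn_Icc hs ha hb
  have cG := hG.continuousOn_Icc hs ha hb
  have hi : IntervalIntegrable (fun x => (f x * G x - F x * g x) / G x ^ 2) volume a b := by
    have e : (fun x => (f x * G x - F x * g x) / G x ^ 2) =
        fun x => f x * (G x / G x ^ 2) - (F x / G x ^ 2) * g x := by
      ext x; ring
    rw [e]
    have hu : uIcc a b = Icc a b := uIcc_of_le hab
    have n2 : ∀ x ∈ Icc a b, G x ^ 2 ≠ 0 := fun x hx => pow_ne_zero 2 (h0 x hx)
    refine ((hF a ha b hb).1.mul_continuousOn ?_).sub ((hG a ha b hb).1.continuousOn_mul ?_)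
    · rw [hu]; exact cG.div (cG.pow 2) n2
    · rw [hu]; exact cF.div (cG.pow 2) n2
  refine ⟨hi, ?_⟩
  refine intervalIntegral.integral_eq_sub_of_hasDeriv_right_of_le hab
    (f := fun x => F x / G x) (cF.div cG h0) (fun x hx => ?_) hi
  have hx' := hs.out ha hb (Ioo_subset_Icc_self hx)
  exact ((hF.hasDerivWithinAt hs hx' hb hx.2 (hf x hx)).div
    (hG.hasDerivWithinAt hs hx' hb hx.2 (hg x hx)) (h0 x (Ioo_subset_Icc_self hx))).mono
    Ioi_subset_Ici_self

/-- `∫ g / G² = 1 / G a - 1 / G b`. -/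
theorem integral_inv_sq (hG : IsPrimitiveOn G g s) (hs : s.OrdConnected)
    (ha : a ∈ s) (hb : b ∈ s) (hab : a ≤ b) (h0 : ∀ x ∈ Icc a b, G x ≠ 0)
    (hg : ∀ x ∈ Ioo a b, ContinuousWithinAt g (Ici x) x) :
    IntervalIntegrable (fun x => g x / G x ^ 2) volume a b ∧
      ∫ x in a..b, g x / G x ^ 2 = 1 / G a - 1 / G b := by
  have h1 : IsPrimitiveOn (fun _ => (1 : ℝ)) (fun _ => 0) s := fun a _ b _ => by simp
  have h := h1.integral_div hG hs ha hb hab h0 (fun x _ => continuousWithinAt_const) hg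
  have e : (fun x => g x / G x ^ 2) = fun x => -((0 * G x - 1 * g x) / G x ^ 2) := by
    ext x; ring
  rw [e]
  refine ⟨h.1.neg, ?_⟩
  rw [intervalIntegral.integral_neg, h.2]
  ring

end IsPrimitiveOn

/-- Absorption of a small multiple of an a priori finite bound. -/
theorem abs_le_of_absorb {ι : Type*} {f : ι → ℝ} {K : ℝ}
    (hfin : ∃ C, ∀ i, |f i| ≤ C)
    (hstep : ∀ C, 0 ≤ C → (∀ i, |f i| ≤ C) → ∀ i, |f i| ≤ K + C / 2) (i : ι) :
    |f i| ≤ 2 * K := by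
  obtain ⟨C₀, hC₀⟩ := hfin
  have hb : BddAbove (range fun i => |f i|) := ⟨C₀, by rintro _ ⟨j, rfl⟩; exact hC₀ j⟩
  have h1 : ∀ j, |f j| ≤ ⨆ i, |f i| := fun j => le_ciSup hb j
  have h2 := hstep _ ((abs_nonneg _).trans (h1 i)) h1
  have : Nonempty ι := ⟨i⟩
  have h3 : (⨆ i, |f i|) ≤ K + (⨆ i, |f i|) / 2 := ciSup_le h2
  linarith [h1 i]

theorem abs_sub_le_of_eVariationOn {f : ℝ → ℝ} {s : Set ℝ} {ε : ℝ} (hε : 0 ≤ ε)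
    (h : eVariationOn f s ≤ ENNReal.ofReal ε) {x y : ℝ} (hx : x ∈ s) (hy : y ∈ s) :
    |f x - f y| ≤ ε := by
  have h1 := (eVariationOn.edist_le f hx hy).trans h
  rw [edist_dist, Real.dist_eq] at h1
  exact (ENNReal.ofReal_le_ofReal_iff hε).1 h1

variable {φ r m : ℝ → ℝ → ℝ} {u v : ℝ}

/-! ### Signs, monotonicity and comparison estimates for BV solutions -/

namespace IsBVSolution

theorem r_pos (h : IsBVSolution φ r m) (hu : 1 ≤ u) (huv : u < v) : 0 < r u v :=
  lt_of_le_of_ne (h.r_nonneg u v hu huv.le)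
    fun e => huv.ne ((h.r_eq_zero_iff u v hu huv.le).1 e.symm)

theorem r_axis (h : IsBVSolution φ r m) (hu : 1 ≤ u) : r u u = 0 :=
  (h.r_eq_zero_iff u u hu le_rfl).2 rfl

theorem r_one (h : IsBVSolution φ r m) (hv : 1 ≤ v) : r 1 v = (v - 1) / 2 := by
  have := h.r_init v hv
  linarith

theorem dvr_one (h : IsBVSolution φ r m) (hv : 1 ≤ v) : dv r 1 v = 1 / 2 := by
  have h1 : HasDerivWithinAt (fun v' => (v' - 1) / 2) (1 / 2 : ℝ) (Ici v) v :=
    (((hasDerivAt_id v).sub_const 1).div_const 2).hasDerivWithinAt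
  have h2 : HasDerivWithinAt (fun v' => r 1 v') (1 / 2 : ℝ) (Ici v) v :=
    h1.congr (fun x hx => h.r_one (hv.trans hx)) (h.r_one hv)
  exact h2.derivWithin (uniqueDiffOn_Ici v v self_mem_Ici)

theorem tendsto_dvr_axis (h : IsBVSolution φ r m) (hu : 1 ≤ u) :
    Tendsto (fun v => dv r u v) (𝓝[>] u) (𝓝 (dv r u u)) :=
  (h.dvr_rightCont u u hu le_rfl).mono_left (nhdsWithin_mono _ Ioi_subset_Ici_self)

theorem tendsto_dvrphi_axis (h : IsBVSolution φ r m) (hu : 1 ≤ u) :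
    Tendsto (fun v => dv (r * φ) u v) (𝓝[>] u) (𝓝 (dv (r * φ) u u)) :=
  (h.dvrphi_rightCont u u hu le_rfl).mono_left (nhdsWithin_mono _ Ioi_subset_Ici_self)

theorem tendsto_sub_nhdsGT (u : ℝ) : Tendsto (fun v => v - u) (𝓝[>] u) (𝓝[>] 0) := by
  refine tendsto_nhdsWithin_iff.2 ⟨?_, ?_⟩
  · have : Tendsto (fun v => v - u) (𝓝 u) (𝓝 (u - u)) := (continuous_id.sub continuous_const).tendsto u
    rw [sub_self] at this
    exact this.mono_left nhdsWithin_le_nhds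
  · filter_upwards [self_mem_nhdsWithin] with v hv
    exact sub_pos.2 (mem_Ioi.1 hv)

/-- The axis condition λ + ν → 0 is used in this form: it transfers information from λ to ν at the
axis. -/
theorem tendsto_dur_axis (h : IsBVSolution φ r m) (hu : 1 ≤ u) :
    Tendsto (fun v => du r u v) (𝓝[>] u) (𝓝 (-dv r u u)) := by
  have h1 := ((h.axis_r u hu).comp (tendsto_sub_nhdsGT u)).sub (h.tendsto_dvr_axis hu)
  simpa [Function.comp_def] using h1

theorem tendsto_durphi_axis (h : IsBVSolution φ r m) (hu : 1 ≤ u) :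
    Tendsto (fun v => du (r * φ) u v) (𝓝[>] u) (𝓝 (-dv (r * φ) u u)) := by
  have h1 := ((h.axis_rphi u hu).comp (tendsto_sub_nhdsGT u)).sub (h.tendsto_dvrphi_axis hu)
  simpa [Function.comp_def] using h1

/-- On an incoming line λ is continuous in u, starts at 1/2 and never vanishes, so it cannot change
sign. -/
theorem dvr_pos_of_lt (h : IsBVSolution φ r m) (hu : 1 ≤ u) (huv : u < v) : 0 < dv r u v := by
  by_contra! hneg
  have hv : 1 ≤ v := hu.trans huv.le
  have hc := (h.eq_dr_u v hv).continuousOn_Icc ordConnected_Ico (a := 1) (b := u)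
    ⟨le_rfl, hu.trans_lt huv⟩ ⟨hu, huv⟩
  have h1 := intermediate_value_Icc' hu hc
  have h2 : (0 : ℝ) ∈ Icc (dv r u v) (dv r 1 v) := ⟨hneg, by rw [h.dvr_one hv]; norm_num⟩
  obtain ⟨x, hx, hx0⟩ := h1 h2
  obtain ⟨C, hC⟩ := h.sup_inv_lambda 1 v le_rfl hv
  exact (hC x v hx.1 (hx.2.trans huv.le) le_rfl).1 hx0

theorem dvr_pos (h : IsBVSolution φ r m) (hu : 1 ≤ u) (huv : u ≤ v) : 0 < dv r u v := by
  rcases huv.lt_or_eq with hlt | rfl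
  · exact h.dvr_pos_of_lt hu hlt
  obtain ⟨C, hC⟩ := h.sup_inv_lambda 1 u le_rfl hu
  refine lt_of_le_of_ne ?_ (hC u u hu le_rfl le_rfl).1.symm
  refine ge_of_tendsto (h.tendsto_dvr_axis hu) ?_
  filter_upwards [self_mem_nhdsWithin] with v hv
  exact (h.dvr_pos_of_lt hu hv).le

/-- On an outgoing line ν is continuous, is negative near the axis as its limit there is -λ, and a
zero of ν would make Ω² vanish. -/
theorem dur_neg (h : IsBVSolution φ r m) (hu : 1 ≤ u) (huv : u < v) : du r u v < 0 := by
  by_contra! hneg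
  have h1 : ∀ᶠ x in 𝓝[>] u, du r u x < 0 :=
    (h.tendsto_dur_axis hu).eventually_lt_const (neg_neg_of_pos (h.dvr_pos hu le_rfl))
  obtain ⟨w, hw, hw1⟩ := (h1.and (Ioo_mem_nhdsGT huv)).exists
  have hc := (h.eq_dr_v u hu).continuousOn_Icc ordConnected_Ioi (a := w) (b := v) hw1.1 huv
  obtain ⟨x, hx, hx0⟩ := intermediate_value_Icc hw1.2.le hc ⟨hw.le, hneg⟩
  have := h.omega_pos u x hu (hw1.1.trans_le hx.1)
  simp [OmegaSq, hx0] at this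

theorem one_sub_massRatio_pos (h : IsBVSolution φ r m) (hu : 1 ≤ u) (huv : u < v) :
    0 < 1 - massRatio r m u v := by
  have h1 := h.omega_pos u v hu huv
  have h2 := mul_pos (h.dvr_pos hu huv.le) (neg_pos.2 (h.dur_neg hu huv))
  by_contra! hneg
  have : OmegaSq r m u v ≤ 0 := by
    unfold OmegaSq
    exact div_nonpos_of_nonneg_of_nonpos (by nlinarith) hneg
  linarith

theorem m_mono (h : IsBVSolution φ r m) (hu : 1 ≤ u) {v₁ v₂ : ℝ} (h₁ : u ≤ v₁) (h₂ : v₁ ≤ v₂) :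
    m u v₁ ≤ m u v₂ := by
  refine (h.eq_dm_v u hu).le_of_nonneg h₁ (h₁.trans h₂) h₂ fun x hx => ?_
  have hux : u < x := h₁.trans_lt hx.1
  have := h.one_sub_massRatio_pos hu hux
  have := h.dvr_pos hu hux.le
  positivity

theorem m_nonneg (h : IsBVSolution φ r m) (hu : 1 ≤ u) (huv : u ≤ v) : 0 ≤ m u v := by
  rw [← h.m_axis u hu]
  exact h.m_mono hu le_rfl huv

theorem m_anti (h : IsBVSolution φ r m) {u₁ u₂ : ℝ} (h₁ : 1 ≤ u₁) (h₂ : u₁ ≤ u₂) (h₃ : u₂ ≤ v) :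
    m u₂ v ≤ m u₁ v := by
  refine (h.eq_dm_u v (h₁.trans (h₂.trans h₃))).le_of_nonpos ⟨h₁, h₂.trans h₃⟩
    ⟨h₁.trans h₂, h₃⟩ h₂ fun x hx => ?_
  have hx1 : 1 ≤ x := h₁.trans hx.1.le
  have hxv : x < v := hx.2.trans_le h₃
  have := h.one_sub_massRatio_pos hx1 hxv
  have := h.dur_neg hx1 hxv
  exact div_nonpos_of_nonneg_of_nonpos (by positivity) (by linarith)

theorem massRatio_nonneg (h : IsBVSolution φ r m) (hu : 1 ≤ u) (huv : u < v) :
    0 ≤ massRatio r m u v :=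
  div_nonneg (mul_nonneg zero_le_two (h.m_nonneg hu huv.le)) (h.r_pos hu huv).le

theorem potential_nonpos (h : IsBVSolution φ r m) (hu : 1 ≤ u) (huv : u < v) :
    potential r m u v ≤ 0 := by
  unfold potential
  have := h.massRatio_nonneg hu huv
  have := h.one_sub_massRatio_pos hu huv
  have := h.r_pos hu huv
  have := h.dvr_pos hu huv.le
  exact mul_nonpos_of_nonneg_of_nonpos (by positivity) (h.dur_neg hu huv).le

theorem potential_eq (r m : ℝ → ℝ → ℝ) (u v : ℝ) : -potential r m u v =
    2 * m u v / ((1 - massRatio r m u v) * r u v ^ 2) * dv r u v * -du r u v := by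
  unfold potential
  nth_rw 1 [massRatio]
  rw [div_div]
  ring_nf

/-- A bound of the potential in a region where `4 m ≤ r`. -/
theorem neg_potential_le (h : IsBVSolution φ r m) (hu : 1 ≤ u) (huv : u < v) {N : ℝ}
    (hN : m u v ≤ N) (hr : 4 * N ≤ r u v) :
    -potential r m u v ≤ 4 * N * dv r u v * (-du r u v) / r u v ^ 2 := by
  have hrp := h.r_pos hu huv
  have h1 : 1 / 2 ≤ 1 - massRatio r m u v := by
    have : massRatio r m u v ≤ 1 / 2 := by
      unfold massRatio
      rw [div_le_iff₀ hrp]; linarith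
    linarith
  have hm := h.m_nonneg hu huv.le
  have hl := h.dvr_pos hu huv.le
  have hn := h.dur_neg hu huv
  rw [potential_eq]
  have h2 : 2 * m u v / ((1 - massRatio r m u v) * r u v ^ 2) ≤ 4 * N / r u v ^ 2 := by
    have h3 : 1 / 2 * r u v ^ 2 ≤ (1 - massRatio r m u v) * r u v ^ 2 := by gcongr
    calc 2 * m u v / ((1 - massRatio r m u v) * r u v ^ 2)
        ≤ 2 * N / (1 / 2 * r u v ^ 2) := by gcongr; linarith
      _ = 4 * N / r u v ^ 2 := by field_simp; ring
  calc _ ≤ 4 * N / r u v ^ 2 * dv r u v * -du r u v := by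
        gcongr; linarith
    _ = _ := by ring

theorem dvr_anti (h : IsBVSolution φ r m) {u₁ u₂ : ℝ} (h₁ : 1 ≤ u₁) (h₂ : u₁ ≤ u₂) (h₃ : u₂ < v) :
    dv r u₂ v ≤ dv r u₁ v :=
  (h.eq_dr_u v (h₁.trans (h₂.trans h₃.le))).le_of_nonpos ⟨h₁, h₂.trans_lt h₃⟩
    ⟨h₁.trans h₂, h₃⟩ h₂ fun _ hx => h.potential_nonpos (h₁.trans hx.1.le) (hx.2.trans h₃)

theorem dvr_le_half (h : IsBVSolution φ r m) (hu : 1 ≤ u) (huv : u ≤ v) : dv r u v ≤ 1 / 2 := by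
  rcases huv.lt_or_eq with hlt | rfl
  · rw [← h.dvr_one (hu.trans huv)]
    exact h.dvr_anti le_rfl hu hlt
  · refine le_of_tendsto (h.tendsto_dvr_axis hu) ?_
    filter_upwards [self_mem_nhdsWithin] with v hv
    rw [← h.dvr_one (hu.trans (le_of_lt hv))]
    exact h.dvr_anti le_rfl hu hv

theorem dur_anti (h : IsBVSolution φ r m) (hu : 1 ≤ u) {v₁ v₂ : ℝ} (h₁ : u < v₁) (h₂ : v₁ ≤ v₂) :
    du r u v₂ ≤ du r u v₁ :=
  (h.eq_dr_v u hu).le_of_nonpos h₁ (h₁.trans_le h₂) h₂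
    fun _ hx => h.potential_nonpos hu (h₁.trans hx.1)

theorem r_mono (h : IsBVSolution φ r m) (hu : 1 ≤ u) {v₁ v₂ : ℝ} (h₁ : u ≤ v₁) (h₂ : v₁ ≤ v₂) :
    r u v₁ ≤ r u v₂ :=
  (h.r_dv u hu).le_of_nonneg h₁ (h₁.trans h₂) h₂
    fun _ hx => (h.dvr_pos hu (h₁.trans hx.1.le)).le

theorem r_anti (h : IsBVSolution φ r m) {u₁ u₂ : ℝ} (h₁ : 1 ≤ u₁) (h₂ : u₁ ≤ u₂) (h₃ : u₂ ≤ v) :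
    r u₂ v ≤ r u₁ v :=
  (h.r_du v (h₁.trans (h₂.trans h₃))).le_of_nonpos ⟨h₁, h₂.trans h₃⟩
    ⟨h₁.trans h₂, h₃⟩ h₂ fun _ hx => (h.dur_neg (h₁.trans hx.1.le) (hx.2.trans_le h₃)).le

theorem r_continuousOn (h : IsBVSolution φ r m) (hu : 1 ≤ u) (v₀ : ℝ) :
    ContinuousOn (fun v => r u v) (Icc u v₀) := by
  rcases lt_or_ge v₀ u with hv | hv
  · simp [Icc_eq_empty (not_le.2 hv)]
  · exact (h.r_dv u hu).continuousOn_Icc ordConnected_Ici self_mem_Ici hv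

/-- The decrease of `λ` from `u₁` to `u₂` in a region where `m ≤ N ≤ r / 4`. -/
theorem dvr_sub_le (h : IsBVSolution φ r m) {u₁ u₂ N : ℝ} (h₁ : 1 ≤ u₁) (h₂ : u₁ ≤ u₂)
    (h₃ : u₂ < v) (hN0 : 0 ≤ N) (hN : m u₁ v ≤ N) (hr : 4 * N ≤ r u₂ v) :
    dv r u₁ v - dv r u₂ v ≤ 2 * N / r u₂ v := by
  have hv : 1 ≤ v := h₁.trans (h₂.trans h₃.le)
  have hpos : ∀ x ∈ Icc u₁ u₂, 0 < r x v := fun x hx => h.r_pos (h₁.trans hx.1) (hx.2.trans_lt h₃)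
  have hI := (h.r_du v hv).integral_inv_sq ordConnected_Icc (a := u₁) (b := u₂)
    ⟨h₁, h₂.trans h₃.le⟩ ⟨h₁.trans h₂, h₃.le⟩ h₂ (fun x hx => (hpos x hx).ne')
    fun x hx => h.dur_rightCont x v (h₁.trans hx.1.le) (hx.2.trans h₃)
  have h4 := (h.eq_dr_u v hv).le_sub_of_le (a := u₁) (b := u₂) ⟨h₁, h₂.trans_lt h₃⟩
    ⟨h₁.trans h₂, h₃⟩ h₂ (hI.1.const_mul (2 * N)) fun x hx => by
      have hx1 := h₁.trans hx.1.le
      have hxv := hx.2.trans h₃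
      have h5 := h.neg_potential_le hx1 hxv ((h.m_anti h₁ hx.1.le hxv.le).trans hN)
        (hr.trans (h.r_anti hx1 hx.2.le h₃.le))
      have h6 := h.dvr_le_half hx1 hxv.le
      have h7 : 4 * N * dv r x v * (-du r x v) / r x v ^ 2
          ≤ 4 * N * (1 / 2) * (-du r x v) / r x v ^ 2 := by
        have := h.dur_neg hx1 hxv
        gcongr; linarith
      have h8 : 4 * N * (1 / 2) * (-du r x v) / r x v ^ 2 = -(2 * N * (du r x v / r x v ^ 2)) := by
        ring
      linarith
  rw [intervalIntegral.integral_const_mul, hI.2] at h4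
  have h9 : 0 ≤ 2 * N * (1 / r u₁ v) := by
    have := hpos u₁ ⟨le_rfl, h₂⟩
    positivity
  have : 2 * N / r u₂ v = 2 * N * (1 / r u₂ v) := by ring
  rw [this]
  linarith

/-- The growth of `-ν` from `v₁` to `v₂` in a region where `m ≤ N ≤ r / 4`. -/
theorem neg_dur_sub_le (h : IsBVSolution φ r m) {v₁ v₂ N : ℝ} (hu : 1 ≤ u) (h₁ : u < v₁)
    (h₂ : v₁ ≤ v₂) (hN0 : 0 ≤ N) (hN : m u v₂ ≤ N) (hr : 4 * N ≤ r u v₁) :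
    -du r u v₂ + du r u v₁ ≤ -du r u v₂ * (4 * N * (1 / r u v₁ - 1 / r u v₂)) := by
  have hpos : ∀ x ∈ Icc v₁ v₂, 0 < r u x := fun x hx => h.r_pos hu (h₁.trans_le hx.1)
  have hI := (h.r_dv u hu).integral_inv_sq ordConnected_Ici (a := v₁) (b := v₂)
    h₁.le (h₁.le.trans h₂) h₂ (fun x hx => (hpos x hx).ne')
    fun x hx => h.dvr_rightCont u x hu (h₁.trans hx.1).le
  -- As -ν increases in v, it is bounded by its value at `v₂`. The bound therefore contains -ν at
  -- the far end, and the callers absorb it when the factor is below 1.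
  have h4 := (h.eq_dr_v u hu).le_sub_of_le (a := v₁) (b := v₂) h₁ (h₁.trans_le h₂) h₂
    (hI.1.const_mul (du r u v₂ * (4 * N))) fun x hx => by
      have hux := h₁.trans hx.1
      have h5 := h.neg_potential_le hu hux ((h.m_mono hu hux.le hx.2.le).trans hN)
        (hr.trans (h.r_mono hu h₁.le hx.1.le))
      have h6 := h.dur_anti hu hux hx.2.le
      have h7 : 4 * N * dv r u x * (-du r u x) / r u x ^ 2
          ≤ 4 * N * dv r u x * (-du r u v₂) / r u x ^ 2 := by
        have := h.dvr_pos hu hux.le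
        gcongr
      have h8 : 4 * N * dv r u x * (-du r u v₂) / r u x ^ 2
          = -(du r u v₂ * (4 * N) * (dv r u x / r u x ^ 2)) := by ring
      linarith
  rw [intervalIntegral.integral_const_mul, hI.2] at h4
  linarith

/-- The variation of `∂_v (r φ)` in `u` is controlled by that of `λ`. -/
theorem dvrphi_sub_le (h : IsBVSolution φ r m) {u₁ u₂ B : ℝ} (h₁ : 1 ≤ u₁) (h₂ : u₁ ≤ u₂)
    (h₃ : u₂ < v) (hB : ∀ x ∈ Ioo u₁ u₂, |φ x v| ≤ B) :
    |dv (r * φ) u₂ v - dv (r * φ) u₁ v| ≤ B * (dv r u₁ v - dv r u₂ v) := by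
  have hv : 1 ≤ v := h₁.trans (h₂.trans h₃.le)
  -- The sign of `potential` is what allows the comparison: |potential · φ| ≤ -B · potential, and
  -- the right side integrates to -Bλ.
  have := (h.eq_dphi_u v hv).abs_sub_le (h.eq_dr_u v hv) (a := u₁) (b := u₂)
    ⟨h₁, h₂.trans_lt h₃⟩ ⟨h₁.trans h₂, h₃⟩ h₂ (C := -B) fun x hx => by
      have hp := h.potential_nonpos (h₁.trans hx.1.le) (hx.2.trans h₃)
      rw [abs_mul, abs_of_nonpos hp]
      nlinarith [hB x hx]
  linarith

/-- The variation of `∂_u (r φ)` in `v` is controlled by that of `ν`. -/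
theorem durphi_sub_le (h : IsBVSolution φ r m) {v₁ v₂ B : ℝ} (hu : 1 ≤ u) (h₁ : u < v₁)
    (h₂ : v₁ ≤ v₂) (hB : ∀ x ∈ Ioo v₁ v₂, |φ u x| ≤ B) :
    |du (r * φ) u v₂ - du (r * φ) u v₁| ≤ B * (du r u v₁ - du r u v₂) := by
  have := (h.eq_dphi_v u hu).abs_sub_le (h.eq_dr_v u hu) (a := v₁) (b := v₂)
    h₁ (h₁.trans_le h₂) h₂ (C := -B) fun x hx => by
      have hp := h.potential_nonpos hu (h₁.trans hx.1)
      rw [abs_mul, abs_of_nonpos hp]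
      nlinarith [hB x hx]
  linarith

end IsBVSolution

/-! ### Mass and scalar field in terms of ∂_v(rφ) on one outgoing line -/

namespace IsBVSolution

theorem hasDerivWithinAt_r (h : IsBVSolution φ r m) (hu : 1 ≤ u) (huv : u ≤ v) :
    HasDerivWithinAt (fun v' => r u v') (dv r u v) (Ici v) v :=
  (h.r_dv u hu).hasDerivWithinAt ordConnected_Ici huv (b := v + 1)
    (mem_Ici.2 (by linarith)) (by linarith) (h.dvr_rightCont u v hu huv)

theorem hasDerivWithinAt_rphi (h : IsBVSolution φ r m) (hu : 1 ≤ u) (huv : u ≤ v) :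
    HasDerivWithinAt (fun v' => (r * φ) u v') (dv (r * φ) u v) (Ici v) v :=
  (h.rphi_dv u hu).hasDerivWithinAt ordConnected_Ici huv (b := v + 1)
    (mem_Ici.2 (by linarith)) (by linarith) (h.dvrphi_rightCont u v hu huv)

theorem r_mul_dv_phi (h : IsBVSolution φ r m) (hu : 1 ≤ u) (huv : u < v) :
    r u v * dv φ u v = dv (r * φ) u v - dv r u v * φ u v := by
  have hr := h.r_pos hu huv
  have h1 := (h.hasDerivWithinAt_rphi hu huv.le).div (h.hasDerivWithinAt_r hu huv.le) hr.ne'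
  have h2 : HasDerivWithinAt (fun v' => φ u v')
      ((dv (r * φ) u v * r u v - (r * φ) u v * dv r u v) / r u v ^ 2) (Ici v) v := by
    refine h1.congr (fun x hx => ?_) ?_
    · have := (h.r_pos hu (huv.trans_le hx)).ne'
      simp only [Pi.mul_apply, Pi.div_apply]
      field_simp
    · simp only [Pi.mul_apply, Pi.div_apply]
      field_simp
  have h3 : dv φ u v = _ := h2.derivWithin (uniqueDiffOn_Ici v v self_mem_Ici)
  rw [h3, Pi.mul_apply, Pi.mul_apply]
  field_simp

theorem dm_v_le (h : IsBVSolution φ r m) (hu : 1 ≤ u) (huv : u < v) :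
    (1 - massRatio r m u v) * r u v ^ 2 * dv φ u v ^ 2 / (2 * dv r u v)
      ≤ (dv (r * φ) u v - dv r u v * φ u v) ^ 2 / (2 * dv r u v) := by
  have h1 := h.massRatio_nonneg hu huv
  have h2 := h.dvr_pos hu huv.le
  rw [← h.r_mul_dv_phi hu huv, mul_pow]
  refine div_le_div_of_nonneg_right ?_ (by positivity)
  have h3 : 0 ≤ r u v ^ 2 * dv φ u v ^ 2 := by positivity
  nlinarith

/-- Since r ∂_v φ = ∂_v(rφ) - λφ, the hypothesis makes ∂_v m at most T²λ/2, and m vanishes on the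
axis. -/
theorem m_le_of_osc (h : IsBVSolution φ r m) (hu : 1 ≤ u) (huv : u ≤ v) {T : ℝ}
    (hT : ∀ x ∈ Ioo u v, |dv (r * φ) u x - dv r u x * φ u x| ≤ T * dv r u x) :
    m u v ≤ T ^ 2 / 2 * r u v := by
  have h1 := (h.eq_dm_v u hu).sub_le_of_le self_mem_Ici huv huv
    (((h.r_dv u hu) u self_mem_Ici v huv).1.const_mul (T ^ 2 / 2)) fun x hx => by
      refine (h.dm_v_le hu hx.1).trans ?_
      have h2 := h.dvr_pos hu hx.1.le
      rw [div_le_iff₀ (by positivity)]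
      have := sq_le_sq' (neg_le_of_abs_le (hT x hx)) (le_of_abs_le (hT x hx))
      nlinarith
  rw [intervalIntegral.integral_const_mul, ← ((h.r_dv u hu) u self_mem_Ici v huv).2,
    h.m_axis u hu] at h1
  simp only [h.r_axis hu] at h1
  linarith

/-- `φ` is an average of `∂_v (r φ) / λ`. -/
theorem abs_phi_sub_le (h : IsBVSolution φ r m) (hu : 1 ≤ u) (huv : u < v) {c T : ℝ}
    (hT : ∀ x ∈ Ioo u v, |dv (r * φ) u x - c * dv r u x| ≤ T * dv r u x) :
    |φ u v - c| ≤ T := by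
  have hr := h.r_pos hu huv
  have h1 := ((h.rphi_dv u hu).sub_const_mul (h.r_dv u hu) c).abs_sub_le (h.r_dv u hu)
    self_mem_Ici huv.le huv.le hT
  simp only [Pi.mul_apply, h.r_axis hu, zero_mul, mul_zero, sub_zero] at h1
  have h2 : r u v * φ u v - c * r u v = r u v * (φ u v - c) := by ring
  rw [h2, abs_mul, abs_of_pos hr, mul_comm] at h1
  exact le_of_mul_le_mul_right h1 hr

theorem abs_phi_le (h : IsBVSolution φ r m) (hu : 1 ≤ u) (huv : u < v) {Λ A : ℝ}
    (hA : 0 ≤ A) (hΛ : ∀ x ∈ Ioo u v, 1 ≤ Λ * dv r u x)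
    (hT : ∀ x ∈ Ioo u v, |dv (r * φ) u x| ≤ A) : |φ u v| ≤ Λ * A := by
  have := h.abs_phi_sub_le hu huv (c := 0) (T := Λ * A) fun x hx => by
    rw [zero_mul, sub_zero]
    nlinarith [hT x hx, hΛ x hx]
  simpa using this

/-- Decay of `φ` from decay of `∂_v (r φ)` on an outgoing line. -/
theorem abs_phi_le_rpow (h : IsBVSolution φ r m) (hu : 1 ≤ u) (huv : u < v) {Λ D ω : ℝ}
    (hω : 1 < ω) (hD : 0 ≤ D) (hΛ : v - u ≤ Λ * r u v)
    (hT : ∀ x ∈ Ioo u v, |dv (r * φ) u x| ≤ D * x ^ (-ω)) :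
    |φ u v| ≤ Λ * (1 + 1 / (ω - 1)) * D * (u ^ (1 - ω) * v⁻¹) := by
  have hr := h.r_pos hu huv
  have hu0 : 0 < u := by linarith
  have hv0 : 0 < v := by linarith
  have hω' : 0 < ω - 1 := by linarith
  have hΛ0 : 0 ≤ Λ := by
    by_contra! hneg
    nlinarith
  have e0 : ((r * φ) u u) = 0 := by simp [h.r_axis hu]
  have h1 := (h.rphi_dv u hu).abs_sub_le
    ((IsPrimitiveOn.rpow (p := -ω) (by linarith)).mono (Ici_subset_Ici.2 hu))
    self_mem_Ici huv.le huv.le hT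
  -- Two bounds are combined: this one integrates x^(-ω) to infinity and is good far out, while `h3`
  -- uses x^(-ω) ≤ u^(-ω) and is good near the axis. They are added with weights v - u and u.
  have h2 : |r u v * φ u v| ≤ D * (u ^ (1 - ω) / (ω - 1)) := by
    rw [e0, sub_zero] at h1
    refine h1.trans (mul_le_mul_of_nonneg_left ?_ hD)
    have e1 : -ω + 1 = -(ω - 1) := by ring
    have e2 : 1 - ω = -(ω - 1) := by ring
    rw [e1, e2, div_neg, div_neg]
    have : 0 ≤ v ^ (-(ω - 1)) / (ω - 1) := by positivity
    linarith
  have h3 : |φ u v| ≤ Λ * (D * u ^ (-ω)) := by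
    have hp : IsPrimitiveOn (fun x => x) (fun _ => (1 : ℝ)) (Ici u) := fun a _ b _ => by simp
    have h4 := (h.rphi_dv u hu).abs_sub_le hp (C := D * u ^ (-ω))
      self_mem_Ici huv.le huv.le fun x hx => by
        refine (hT x hx).trans ?_
        rw [mul_one]
        exact mul_le_mul_of_nonneg_left
          (Real.rpow_le_rpow_of_nonpos hu0 hx.1.le (by linarith)) hD
    rw [e0, sub_zero, Pi.mul_apply, Pi.mul_apply, abs_mul, abs_of_pos hr] at h4
    have h5 : 0 ≤ D * u ^ (-ω) := by positivity
    refine le_of_mul_le_mul_left (a := r u v) ?_ hr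
    nlinarith [mul_le_mul_of_nonneg_left hΛ h5]
  rw [abs_mul, abs_of_pos hr] at h2
  have h6 : v * |φ u v| ≤ Λ * (1 + 1 / (ω - 1)) * D * u ^ (1 - ω) := by
    have h7 : (v - u) * |φ u v| ≤ Λ * (D * (u ^ (1 - ω) / (ω - 1))) := by
      calc (v - u) * |φ u v| ≤ Λ * r u v * |φ u v| := by gcongr
        _ = Λ * (r u v * |φ u v|) := by ring
        _ ≤ _ := by gcongr
    have h8 : u * |φ u v| ≤ Λ * (D * u ^ (1 - ω)) := by
      calc u * |φ u v| ≤ u * (Λ * (D * u ^ (-ω))) := by gcongr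
        _ = Λ * (D * (u ^ (1 : ℝ) * u ^ (-ω))) := by rw [Real.rpow_one]; ring
        _ = _ := by rw [← Real.rpow_add hu0]; ring_nf
    calc v * |φ u v| = (v - u) * |φ u v| + u * |φ u v| := by ring
      _ ≤ Λ * (D * (u ^ (1 - ω) / (ω - 1))) + Λ * (D * u ^ (1 - ω)) := add_le_add h7 h8
      _ = _ := by ring
  have h9 : |φ u v| = v * |φ u v| * v⁻¹ := by field_simp
  rw [h9, ← mul_assoc]
  gcongr

/-- By right-continuity ∂_v(rφ)/λ is close to its axis value c near the axis, and so is its average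
φ; the mass is then a small multiple of r. -/
theorem exists_osc_le_near_axis (h : IsBVSolution φ r m) (hu : 1 ≤ u) :
    ∃ v₀ > u, ∀ v, u < v → v ≤ v₀ → massRatio r m u v ≤ 1 / 2 := by
  set c := dv (r * φ) u u / dv r u u with hc
  have hl0 := h.dvr_pos hu le_rfl
  have h1 : Tendsto (fun x => |dv (r * φ) u x - c * dv r u x| - 1 / 4 * dv r u x) (𝓝[>] u)
      (𝓝 (|dv (r * φ) u u - c * dv r u u| - 1 / 4 * dv r u u)) :=
    ((h.tendsto_dvrphi_axis hu).sub ((h.tendsto_dvr_axis hu).const_mul c)).abs.sub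
      ((h.tendsto_dvr_axis hu).const_mul _)
  have h2 : |dv (r * φ) u u - c * dv r u u| - 1 / 4 * dv r u u < 0 := by
    have : dv (r * φ) u u - c * dv r u u = 0 := by rw [hc]; field_simp; simp
    rw [this, abs_zero]; linarith
  obtain ⟨v₀, hv₀, h3⟩ := (mem_nhdsGT_iff_exists_Ioo_subset).1 (h1.eventually_lt_const h2)
  rw [mem_Ioi] at hv₀
  refine ⟨(u + v₀) / 2, by linarith, fun v huv hv => ?_⟩
  have h4 : ∀ x ∈ Ioo u v₀, |dv (r * φ) u x - c * dv r u x| ≤ 1 / 4 * dv r u x := fun x hx => by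
    have := h3 hx
    simp only [mem_ofPred_eq] at this
    linarith
  have h5 : ∀ x ∈ Ioo u v, |dv (r * φ) u x - dv r u x * φ u x| ≤ 1 / 2 * dv r u x := by
    intro x hx
    have hx0 : x ∈ Ioo u v₀ := ⟨hx.1, by linarith [hx.2]⟩
    have h6 := h.abs_phi_sub_le hu hx.1 fun y hy => h4 y ⟨hy.1, hy.2.trans hx0.2⟩
    have hl := h.dvr_pos hu hx.1.le
    have e : dv (r * φ) u x - dv r u x * φ u x
        = (dv (r * φ) u x - c * dv r u x) - dv r u x * (φ u x - c) := by ring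
    rw [e]
    refine (abs_sub _ _).trans ?_
    rw [abs_mul, abs_of_pos hl]
    nlinarith [h4 x hx0]
  have h6 := h.m_le_of_osc hu huv.le h5
  rw [massRatio, div_le_iff₀ (h.r_pos hu huv)]
  nlinarith [h.r_pos hu huv]

end IsBVSolution

/-! ### Consequences of asymptotic flatness of the data -/

variable {ω : ℝ}

theorem IsAsymptoticallyFlatBV.abs_dvrphi_one_le (hf : IsAsymptoticallyFlatBV φ r ω)
    (h : IsBVSolution φ r m) : ∃ D > 0, ∀ v, 1 ≤ v → |dv (r * φ) 1 v| ≤ D * v ^ (-ω) := by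
  obtain ⟨I, hI, hb⟩ := hf.bound
  have hω := hf.one_lt
  refine ⟨2 ^ ω * I, by positivity, fun v hv => ?_⟩
  have hv0 : 0 < v := by linarith
  have h1 := hb v hv
  rw [h.r_one hv] at h1
  have h2 : (v / 2) ^ ω ≤ (1 + (v - 1) / 2) ^ ω :=
    Real.rpow_le_rpow (by positivity) (by linarith) (by linarith)
  have h3 : (v / 2) ^ ω * |dv (r * φ) 1 v| ≤ I :=
    (mul_le_mul_of_nonneg_right h2 (abs_nonneg _)).trans h1
  rw [Real.div_rpow hv0.le zero_le_two] at h3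
  have h4 : 0 < v ^ ω := by positivity
  have h5 : (0 : ℝ) < 2 ^ ω := by positivity
  rw [Real.rpow_neg hv0.le]
  field_simp at h3 ⊢
  linarith

/-- The mass decreases in u, so only the initial line matters. There both ∂_v(rφ) and φ are O(1/v),
which makes ∂_v m = O(v⁻²). -/
theorem IsAsymptoticallyFlatBV.exists_mass_bound (hf : IsAsymptoticallyFlatBV φ r ω)
    (h : IsBVSolution φ r m) : ∃ N > 0, ∀ u v, 1 ≤ u → u ≤ v → m u v ≤ N := by
  obtain ⟨D, hD, hb⟩ := hf.abs_dvrphi_one_le h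
  have hω := hf.one_lt
  set C := 2 * (1 + 1 / (ω - 1)) * D with hC
  have hω' : 0 < ω - 1 := by linarith
  have hC0 : 0 < C := by positivity
  refine ⟨(D + C) ^ 2, by positivity, fun u v hu huv => (h.m_anti le_rfl hu huv).trans ?_⟩
  have hv : 1 ≤ v := hu.trans huv
  have hφ : ∀ x, 1 < x → |φ 1 x| ≤ C * x⁻¹ := fun x hx => by
    have := h.abs_phi_le_rpow le_rfl hx (Λ := 2) hω hD.le (by rw [h.r_one hx.le]; linarith)
      fun y hy => hb y hy.1.le
    rwa [Real.one_rpow, one_mul] at this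
  have hp := (IsPrimitiveOn.rpow (p := -2) (by norm_num)).mono (Ici_subset_Ici.2 (le_refl 1))
  have h1 := (h.eq_dm_v 1 le_rfl).abs_sub_le hp (C := (D + C) ^ 2) self_mem_Ici hv hv
    fun x hx => by
      have hx0 : (0 : ℝ) < x := by linarith [hx.1]
      have h2 := h.dm_v_le le_rfl hx.1
      have h3 := h.dvr_one hx.1.le
      have h4 := h.one_sub_massRatio_pos le_rfl hx.1
      rw [abs_of_nonneg (by have := h.dvr_pos le_rfl hx.1.le; positivity)]
      refine h2.trans ?_
      rw [h3]
      have h5 : |dv (r * φ) 1 x| ≤ D * x⁻¹ := by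
        refine (hb x hx.1.le).trans (mul_le_mul_of_nonneg_left ?_ hD.le)
        rw [← Real.rpow_neg_one]
        exact Real.rpow_le_rpow_of_exponent_le hx.1.le (by linarith)
      have h6 : |dv (r * φ) 1 x - 1 / 2 * φ 1 x| ≤ (D + C) * x⁻¹ := by
        refine (abs_sub _ _).trans ?_
        rw [abs_mul, abs_of_pos (by norm_num : (0 : ℝ) < 1 / 2), add_mul]
        nlinarith [hφ x hx.1, abs_nonneg (φ 1 x)]
      have h7 := sq_le_sq' (neg_le_of_abs_le h6) (le_of_abs_le h6)
      rw [mul_pow, inv_pow] at h7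
      have e : x ^ (-2 : ℝ) = (x ^ 2)⁻¹ := by
        rw [Real.rpow_neg hx0.le]; norm_cast
      rw [e]
      simpa using h7
  rw [h.m_axis 1 le_rfl, sub_zero] at h1
  refine (le_abs_self _).trans (h1.trans (mul_le_of_le_one_right (by positivity) ?_))
  have : 0 < v ^ ((-2 : ℝ) + 1) := by positivity
  norm_num at this ⊢
  linarith

/-! ### Unboundedness of r and convergence of λ to 1/2 -/

namespace IsLocallyBVScattering

theorem exists_mass_le (h : IsLocallyBVScattering φ r m) {ε : ℝ} (hε : 0 < ε) :
    ∀ᶠ u in atTop, ∀ v, u ≤ v → m u v ≤ ε := by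
  obtain ⟨M, hM, hM0⟩ := h.final_bondi_mass
  have h1 : ∀ᶠ u in atTop, M u < (ε : EReal) :=
    hM0.eventually_lt_const (by exact_mod_cast hε)
  filter_upwards [h1, eventually_ge_atTop 1] with u hu hu1 v huv
  have h2 : (m u v : EReal) ≤ M u := by
    refine ge_of_tendsto (hM u hu1) ?_
    filter_upwards [eventually_ge_atTop v] with w hw
    exact_mod_cast h.m_mono hu1 huv hw
  exact_mod_cast h2.trans hu.le

/-- An outgoing line along which `r` is bounded and eventually exceeds `4 m` is incomplete. -/
theorem r_le_of_bounded (h : IsLocallyBVScattering φ r m) (hu : 1 ≤ u) {B N : ℝ} (hN0 : 0 < N)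
    (hB : ∀ v, u ≤ v → r u v ≤ B) (hN : ∀ v, u ≤ v → m u v ≤ N) (hv : u ≤ v) : r u v ≤ 4 * N := by
  by_contra! hlt
  -- Since r is bounded, its remaining increase past some `v₁` is at most 2N. With r > 4N this gives
  -- 4N(1/r(v₁) - 1/r(w)) ≤ 1/2, so -ν at most doubles after `v₁`; hence the constant `K`.
  obtain ⟨v₁, hv₁, hr₁⟩ : ∃ v₁ ≥ v, ∀ w ≥ v₁, r u w - r u v₁ ≤ 2 * N := by
    have hne : ((fun w => r u w) '' Ici u).Nonempty := ⟨_, mem_image_of_mem _ self_mem_Ici⟩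
    have hbd : BddAbove ((fun w => r u w) '' Ici u) := ⟨B, by rintro _ ⟨w, hw, rfl⟩; exact hB w hw⟩
    obtain ⟨_, ⟨w, hw, rfl⟩, hw1⟩ := exists_lt_of_lt_csSup hne
      (show sSup ((fun w => r u w) '' Ici u) - 2 * N < _ by linarith)
    refine ⟨max v w, le_max_left _ _, fun x hx => ?_⟩
    have h1 := le_csSup hbd (mem_image_of_mem (fun w => r u w) (mem_Ici.2 (hv.trans
      ((le_max_left v w).trans hx))))
    have h2 := h.r_mono hu hw (le_max_right v w)
    simp only at h1 hw1
    linarith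
  have hvu : u < v := by
    rcases hv.lt_or_eq with hlt' | rfl
    · exact hlt'
    · rw [h.r_axis hu] at hlt; linarith
  have huv₁ : u < v₁ := hvu.trans_le hv₁
  have hrv₁ : 4 * N < r u v₁ := hlt.trans_le (h.r_mono hu hv hv₁)
  set K := -(2 * du r u v₁) with hK
  have hK0 : 0 < K := by have := h.dur_neg hu huv₁; linarith
  have hnu : ∀ w, u < w → -du r u w ≤ K := by
    intro w hw
    rcases le_total w v₁ with hle | hle
    · have := h.dur_anti hu hw hle
      have := h.dur_neg hu huv₁
      linarith
    · have h1 := h.neg_dur_sub_le hu huv₁ hle hN0.le (hN w hw.le) hrv₁.le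
      have hrw := h.r_mono hu huv₁.le hle
      have h2 : 4 * N * (1 / r u v₁ - 1 / r u w) ≤ 1 / 2 := by
        have h3 : 0 < r u v₁ := by linarith
        have h4 : 0 < r u w := by linarith
        rw [div_sub_div _ _ h3.ne' h4.ne', ← mul_div_assoc, div_le_iff₀ (by positivity)]
        have := hr₁ w hle
        nlinarith
      have h5 := h.dur_neg hu hw
      nlinarith
  obtain ⟨c, hc0, hc⟩ : ∃ c > 0, ∀ w, u < w → c ≤ 1 - massRatio r m u w := by
    obtain ⟨v₀, hv₀, h1⟩ := h.exists_osc_le_near_axis hu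
    have hcont : ContinuousOn (fun w => 1 - massRatio r m u w) (Icc v₀ v₁) := by
      have hm := ((h.eq_dm_v u hu).continuousOn_Icc ordConnected_Ici self_mem_Ici
        (mem_Ici.2 huv₁.le)).mono (Icc_subset_Icc_left (le_of_lt hv₀))
      have hr := (h.r_continuousOn hu v₁).mono (Icc_subset_Icc_left (le_of_lt hv₀))
      exact continuousOn_const.sub ((continuousOn_const.mul hm).div hr
        fun x hx => (h.r_pos hu (lt_of_lt_of_le hv₀ hx.1)).ne')
    have h3 : ∀ w, v₁ ≤ w → 1 / 2 ≤ 1 - massRatio r m u w := fun w hw => by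
      have hrw := h.r_mono hu huv₁.le hw
      have h4 : massRatio r m u w ≤ 1 / 2 := by
        rw [massRatio, div_le_iff₀ (by linarith)]
        linarith [hN w (huv₁.le.trans hw)]
      linarith
    rcases le_total v₁ v₀ with hle | hle
    · refine ⟨1 / 2, by norm_num, fun w hw => ?_⟩
      rcases le_total w v₀ with hw' | hw'
      · linarith [h1 w hw hw']
      · exact h3 w (hle.trans hw')
    · obtain ⟨x, hx, hmin⟩ := isCompact_Icc.exists_isMinOn (nonempty_Icc.2 hle) hcont
      have hx0 := h.one_sub_massRatio_pos hu (lt_of_lt_of_le hv₀ hx.1)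
      refine ⟨min (1 / 2) (1 - massRatio r m u x), by positivity, fun w hw => ?_⟩
      rcases le_total w v₀ with hw' | hw'
      · exact (min_le_left _ _).trans (by linarith [h1 w hw hw'])
      rcases le_total w v₁ with hw'' | hw''
      · exact (min_le_right _ _).trans (hmin ⟨hw', hw''⟩)
      · exact (min_le_left _ _).trans (h3 w hw'')
  -- With -ν bounded above and 1 - μ bounded below, Ω² is at most a multiple of λ, whose integral is
  -- the bounded increase of r. This contradicts completeness.
  have hO : ∀ w ∈ Ioi u, ENNReal.ofReal (OmegaSq r m u w) ≤
      ENNReal.ofReal (4 * K / c * dv r u w) := fun w hw => by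
    refine ENNReal.ofReal_le_ofReal ?_
    have h1 := hc w hw
    have h2 := h.dvr_pos hu (le_of_lt hw)
    have h3 := hnu w hw
    have h4 := h.dur_neg hu hw
    have e : OmegaSq r m u w = 4 * (-du r u w) / (1 - massRatio r m u w) * dv r u w := by
      unfold OmegaSq; ring
    rw [e]
    gcongr
  have hint : IntegrableOn (fun w => dv r u w) (Ioi u) := by
    have h1 : ∀ w : ℝ, IntervalIntegrable (fun w => dv r u w) volume u (max u w) :=
      fun w => ((h.r_dv u hu) u self_mem_Ici (max u w) (mem_Ici.2 (le_max_left _ _))).1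
    refine integrableOn_Ioi_of_intervalIntegral_norm_bounded (l := atTop) (b := fun w => max u w)
      B u (fun w => ?_) (tendsto_atTop_mono (fun w => le_max_right u w) tendsto_id)
      (Eventually.of_forall fun w => ?_)
    · exact (h1 w).1
    · have h2 : ∫ x in u..max u w, ‖dv r u x‖ = ∫ x in u..max u w, dv r u x := by
        refine intervalIntegral.integral_congr fun x hx => ?_
        rw [uIcc_of_le (le_max_left _ _)] at hx
        exact Real.norm_of_nonneg (h.dvr_pos hu hx.1).le
      rw [h2, ← ((h.r_dv u hu) u self_mem_Ici (max u w) (mem_Ici.2 (le_max_left _ _))).2]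
      simp only [h.r_axis hu, sub_zero]
      exact hB _ (le_max_left _ _)
  have h1 := h.complete_outgoing u hu
  have h2 : ∫⁻ w in Ioi u, ENNReal.ofReal (4 * K / c * dv r u w) < ⊤ :=
    (hint.const_mul (4 * K / c)).lintegral_lt_top
  have h3 := setLIntegral_mono' (μ := volume) measurableSet_Ioi hO
  rw [h1] at h3
  exact absurd (h3.trans_lt h2) (lt_irrefl _)

/-- If r stayed below B on one line, it would on all later ones. On a late line the mass is at most
R/4, so completeness forces r ≤ R throughout; the whole line then lies where log λ has variation at
most 1, so λ is bounded below and r grows linearly, a contradiction. -/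
theorem exists_le_r (h : IsLocallyBVScattering φ r m) (hu : 1 ≤ u) (B : ℝ) :
    ∃ v₀ ≥ u, ∀ v ≥ v₀, B ≤ r u v := by
  suffices hs : ∃ v₀ ≥ u, B ≤ r u v₀ by
    obtain ⟨v₀, h1, h2⟩ := hs
    exact ⟨v₀, h1, fun v hv => h2.trans (h.r_mono hu h1 hv)⟩
  by_contra! hB
  obtain ⟨R, hR, -, hl⟩ := h.scattering
  obtain ⟨w, hw1, hw2, hw3⟩ := ((h.exists_mass_le (by positivity : 0 < R / 4)).and
    ((hl.eventually_le_const (u := ENNReal.ofReal 1) (by simp)).and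
      (eventually_ge_atTop u))).exists
  have hw : 1 ≤ w := hu.trans hw3
  have hBw : ∀ v, w ≤ v → r w v ≤ B := fun v hv =>
    (h.r_anti hu hw3 hv).trans (hB v (hw3.trans hv)).le
  have hRw : ∀ v, w ≤ v → r w v ≤ R := fun v hv => by
    have := h.r_le_of_bounded hw (by positivity) hBw hw1 hv
    linarith
  set c := Real.exp (Real.log (dv r w w) - 1) with hc
  have hc0 : 0 < c := Real.exp_pos _
  have hlow : ∀ v, w ≤ v → c ≤ dv r w v := fun v hv => by
    have h1 := abs_sub_le_of_eVariationOn zero_le_one hw2 (x := w) (y := v)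
      ⟨le_rfl, hRw w le_rfl⟩ ⟨hv, hRw v hv⟩
    rw [← Real.le_log_iff_exp_le (h.dvr_pos hw hv)]
    linarith [(abs_le.1 h1).2]
  have hB0 : 0 ≤ B := by
    have := hBw w le_rfl
    rwa [h.r_axis hw] at this
  have h2 : w ≤ w + (B + 1) / c := by
    have : 0 < (B + 1) / c := by positivity
    linarith
  have h3 := (h.r_dv w hw).le_sub_of_le (g := fun _ => c) self_mem_Ici (mem_Ici.2 h2) h2 (by simp)
    fun x hx => hlow x hx.1.le
  simp only [intervalIntegral.integral_const, h.r_axis hw, smul_eq_mul] at h3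
  rw [add_sub_cancel_left, div_mul_cancel₀ _ hc0.ne'] at h3
  linarith [hBw _ h2]

theorem exists_r_eq (h : IsLocallyBVScattering φ r m) (hu : 1 ≤ u) {R : ℝ} (hR : 0 < R) :
    ∃ b > u, r u b = R := by
  obtain ⟨v₀, hv₀, hr⟩ := h.exists_le_r hu R
  have h1 := intermediate_value_Icc hv₀ (h.r_continuousOn hu v₀)
  obtain ⟨b, hb, hb1⟩ := h1 (show R ∈ Icc (r u u) (r u v₀) from
    ⟨by rw [h.r_axis hu]; exact hR.le, hr v₀ le_rfl⟩)
  refine ⟨b, lt_of_le_of_ne hb.1 ?_, hb1⟩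
  rintro rfl
  simp only [h.r_axis hu] at hb1
  exact hR.ne hb1

/-- `λ` tends to `1 / 2` uniformly. -/
theorem eventually_half_sub_le (h : IsLocallyBVScattering φ r m)
    (hf : IsAsymptoticallyFlatBV φ r ω) {ε : ℝ} (hε : 0 < ε) :
    ∀ᶠ v in atTop, ∀ u, 1 ≤ u → u ≤ v → 1 / 2 - ε ≤ dv r u v := by
  obtain ⟨N, hN0, hN⟩ := hf.exists_mass_bound h.toIsBVSolution
  obtain ⟨R, hR, -, hl⟩ := h.scattering
  set N' := min (R / 4) (ε * R / 8) with hN'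
  have hN'0 : 0 < N' := by positivity
  obtain ⟨U, hU⟩ := eventually_atTop.1 ((h.exists_mass_le hN'0).and
    ((hl.eventually_le_const (u := ENNReal.ofReal (ε / 2)) (by simpa using hε)).and
      (eventually_ge_atTop 1)))
  have hU1 : 1 ≤ U := (hU U le_rfl).2.2
  obtain ⟨v₀, hv₀, hr₀⟩ := h.exists_le_r hU1 (max (4 * N) (8 * N / ε))
  -- For u ≤ U the mass is merely bounded, but r is at least 8N/ε once v > v₀, since r(u,v) ≥
  -- r(U,v).
  have hnear : ∀ u v, 1 ≤ u → u ≤ U → v₀ < v → 1 / 2 - ε / 4 ≤ dv r u v := by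
    intro u v hu huU hv
    have hUv : U < v := lt_of_le_of_lt hv₀ hv
    have hru := (hr₀ v hv.le).trans (h.r_anti hu huU hUv.le)
    have h1 := h.dvr_sub_le le_rfl hu (huU.trans_lt hUv) hN0.le
      (hN 1 v le_rfl (hU1.trans hUv.le)) ((le_max_left _ _).trans hru)
    have h2 : 2 * N / r u v ≤ ε / 4 := by
      have h3 : 8 * N / ε ≤ r u v := (le_max_right _ _).trans hru
      have h4 := h.r_pos hu (huU.trans_lt hUv)
      rw [div_le_iff₀ hε] at h3
      rw [div_le_iff₀ h4]
      linarith
    rw [h.dvr_one (hU1.trans hUv.le)] at h1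
    linarith
  -- For u ≥ U and r ≥ R it is the mass that is small: the drop of λ since U is at most 2N'/R ≤ ε/4.
  have hfar : ∀ u v, 1 ≤ u → v₀ < v → u < v → R ≤ r u v → 1 / 2 - ε / 2 ≤ dv r u v := by
    intro u v hu hv huv hRr
    rcases le_total u U with huU | huU
    · linarith [hnear u v hu huU hv]
    · have h1 := h.dvr_sub_le hU1 huU huv hN'0.le ((hU U le_rfl).1 v (huU.trans huv.le))
        (by linarith [min_le_left (R / 4) (ε * R / 8)])
      have h2 : 2 * N' / r u v ≤ ε / 4 := by
        rw [div_le_iff₀ (by linarith)]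
        nlinarith [min_le_right (R / 4) (ε * R / 8)]
      linarith [hnear U v hU1 le_rfl hv]
  filter_upwards [eventually_gt_atTop v₀] with v hv u hu huv
  rcases le_total u U with huU | huU
  · linarith [hnear u v hu huU hv]
  rcases le_total R (r u v) with hRr | hRr
  · have huv' : u < v := by
      rcases huv.lt_or_eq with hlt | rfl
      · exact hlt
      · rw [h.r_axis hu] at hRr; linarith
    linarith [hfar u v hu hv huv' hRr]
  -- For r ≤ R, λ is compared with its value where r = R, through the small variation of log λ. That
  -- point lies at b ≥ v > v₀, so `hfar` applies to it.
  · obtain ⟨b, hub, hb⟩ := h.exists_r_eq hu hR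
    have hvb : v ≤ b := by
      by_contra! hlt
      have h1 : r u v = R := le_antisymm hRr (hb ▸ h.r_mono hu hub.le hlt.le)
      have h2 := (h.r_dv u hu).le_sub_of_le (g := fun _ => 0) hub.le huv hlt.le (by simp)
        fun x hx => (h.dvr_pos hu (hub.trans hx.1).le).le
      have h3 := ((h.r_dv u hu) b hub.le v huv).2
      have h4 := intervalIntegral.intervalIntegral_pos_of_pos_on
        ((h.r_dv u hu) b hub.le v huv).1 (fun x hx => h.dvr_pos hu (hub.trans hx.1).le) hlt
      simp only at h3
      linarith
    have h1 := hfar u b hu (hv.trans_le hvb) hub hb.ge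
    have h2 := abs_sub_le_of_eVariationOn (by positivity) (hU u huU).2.1 (x := v) (y := b)
      ⟨huv, hRr⟩ ⟨hub.le, hb.le⟩
    have hlb := h.dvr_pos hu hub.le
    have hlv := h.dvr_pos hu huv
    have h3 : 1 - ε / 2 ≤ dv r u v / dv r u b := by
      have h4 : Real.log (dv r u v / dv r u b) = Real.log (dv r u v) - Real.log (dv r u b) :=
        Real.log_div hlv.ne' hlb.ne'
      have h5 := Real.log_le_sub_one_of_pos (div_pos hlv hlb)
      linarith [(abs_le.1 h2).1]
    rw [le_div_iff₀ hlb] at h3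
    nlinarith [h.dvr_le_half hu hub.le]

theorem exists_lambda_lower (h : IsLocallyBVScattering φ r m)
    (hf : IsAsymptoticallyFlatBV φ r ω) :
    ∃ Λ ≥ 1, (∀ u v, 1 ≤ u → u ≤ v → 1 ≤ Λ * dv r u v) ∧
      ∀ u v, 1 ≤ u → u ≤ v → v - u ≤ Λ * r u v := by
  obtain ⟨v₁, hv₁⟩ := eventually_atTop.1
    (h.eventually_half_sub_le hf (by norm_num : (0 : ℝ) < 1 / 4))
  obtain ⟨C, hC⟩ := h.sup_inv_lambda 1 (max 1 v₁) le_rfl (le_max_left _ _)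
  have key : ∀ u v, 1 ≤ u → u ≤ v → 1 ≤ max 4 C * dv r u v := by
    intro u v hu huv
    have hl := h.dvr_pos hu huv
    rcases le_total v₁ v with hle | hle
    · have := hv₁ v hle u hu huv
      have := le_max_left 4 C
      nlinarith
    · have h1 := (hC u v hu huv (hle.trans (le_max_right _ _))).2
      calc (1 : ℝ) = (dv r u v)⁻¹ * dv r u v := by field_simp
        _ ≤ max 4 C * dv r u v := by
          gcongr; exact h1.trans (le_max_right _ _)
  refine ⟨max 4 C, by linarith [le_max_left 4 C], key, fun u v hu huv => ?_⟩
  have hp : IsPrimitiveOn (fun x => x) (fun _ => (1 : ℝ)) (Ici u) := fun a _ b _ => by simp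
  have h2 := hp.abs_sub_le (h.r_dv u hu) self_mem_Ici huv huv (C := max 4 C) fun x hx => by
    rw [abs_one]
    exact key u x hu hx.1.le
  simp only [h.r_axis hu, sub_zero] at h2
  exact (le_abs_self _).trans h2

end IsLocallyBVScattering

/-! ### Uniform bounds for φ and ∂_v(rφ) -/

/-- Absorption of a small multiple of an a priori bound on the domains of dependence. -/
theorem abs_le_of_absorb_domains {f : ℝ → ℝ → ℝ} {K : ℝ}
    (hfin : ∀ v₀, ∃ C, ∀ u v, 1 ≤ u → u < v → v ≤ v₀ → |f u v| ≤ C)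
    (hstep : ∀ v₀ C, 0 ≤ C → (∀ u v, 1 ≤ u → u < v → v ≤ v₀ → |f u v| ≤ C) →
      ∀ u v, 1 ≤ u → u < v → v ≤ v₀ → |f u v| ≤ K + C / 2)
    (hu : 1 ≤ u) (huv : u < v) : |f u v| ≤ 2 * K := by
  obtain ⟨C₀, hC₀⟩ := hfin v
  refine abs_le_of_absorb (ι := {p : ℝ × ℝ // 1 ≤ p.1 ∧ p.1 < p.2 ∧ p.2 ≤ v})
    (f := fun p => f p.1.1 p.1.2) ⟨C₀, fun p => hC₀ _ _ p.2.1 p.2.2.1 p.2.2.2⟩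
    (fun C hC hb p => hstep v C hC (fun x y h1 h2 h3 => hb ⟨(x, y), h1, h2, h3⟩)
      _ _ p.2.1 p.2.2.1 p.2.2.2) ⟨(u, v), hu, huv, le_rfl⟩

/-- Only the finiteness matters: it makes the absorption argument legitimate on each compact domain.
-/
theorem IsBVSolution.exists_phi_bound (h : IsBVSolution φ r m) (v₀ : ℝ) :
    ∃ C, ∀ u v, 1 ≤ u → u < v → v ≤ v₀ → |φ u v| ≤ C := by
  rcases lt_or_ge v₀ 1 with hv₀ | hv₀
  · exact ⟨0, fun u v h1 h2 h3 => by linarith⟩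
  obtain ⟨T, hT⟩ := h.phi_bv_v 1 (v₀ + 1) le_rfl (by linarith)
  obtain ⟨T', hT'⟩ := h.phi_bv_u 1 (v₀ + 1) le_rfl (by linarith)
  refine ⟨T + T' + |φ 1 (v₀ + 1)|, fun u v hu huv hv => ?_⟩
  have h1 := hT u ⟨hu, by linarith⟩
  have h2 := hT' (v₀ + 1) ⟨by linarith, le_rfl⟩
  rw [← ENNReal.ofReal_coe_nnreal] at h1 h2
  have h3 := abs_sub_le_of_eVariationOn T.2 h1 (x := v) (y := v₀ + 1) ⟨huv.le, by linarith⟩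
    ⟨by linarith, le_rfl⟩
  have h4 := abs_sub_le_of_eVariationOn T'.2 h2 (x := u) (y := 1) ⟨hu, by linarith⟩
    ⟨le_rfl, by linarith⟩
  have e : φ u v = (φ u v - φ u (v₀ + 1)) + (φ u (v₀ + 1) - φ 1 (v₀ + 1)) + φ 1 (v₀ + 1) := by ring
  rw [e]
  exact (abs_add_three _ _ _).trans (add_le_add (add_le_add h3 h4) le_rfl)

theorem IsLocallyBVScattering.exists_bound (h : IsLocallyBVScattering φ r m)
    (hf : IsAsymptoticallyFlatBV φ r ω) :
    ∃ A > 0, ∀ u v, 1 ≤ u → u < v → |dv (r * φ) u v| ≤ A ∧ |φ u v| ≤ A := by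
  obtain ⟨Λ, hΛ1, hΛ, -⟩ := h.exists_lambda_lower hf
  obtain ⟨D, hD0, hD⟩ := hf.abs_dvrphi_one_le h.toIsBVSolution
  have hω := hf.one_lt
  have hΛ0 : 0 < Λ := by linarith
  -- Beyond `v₁` the total drop of λ is at most 1/(2Λ). Averaging ∂_v(rφ)/λ to recover φ costs a
  -- factor Λ, so the supremum of |φ| returns with coefficient 1/2 and is absorbed.
  obtain ⟨v₁, hv₁⟩ := eventually_atTop.1
    (h.eventually_half_sub_le hf (by positivity : (0 : ℝ) < 1 / (2 * Λ)))
  obtain ⟨C', hC'⟩ := h.exists_phi_bound v₁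
  set C := max C' 0 with hC
  have hC0 : 0 ≤ C := le_max_right _ _
  have hD1 : ∀ v, 1 ≤ v → |dv (r * φ) 1 v| ≤ D := fun v hv =>
    (hD v hv).trans (mul_le_of_le_one_right hD0.le (Real.rpow_le_one_of_one_le_of_nonpos hv
      (by linarith)))
  have hstep : ∀ v₀ B, 0 ≤ B → (∀ u v, 1 ≤ u → u < v → v ≤ v₀ → |φ u v| ≤ B) →
      ∀ u v, 1 ≤ u → u < v → v ≤ v₀ → |dv (r * φ) u v| ≤ D + C / 2 + B * (1 / (2 * Λ)) := by
    intro v₀ B hB hb u v hu huv hv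
    have h0 := hD1 v (hu.trans huv.le)
    have hl := h.dvr_one (hu.trans huv.le)
    have h3 : |dv (r * φ) u v| ≤ |dv (r * φ) u v - dv (r * φ) 1 v| + |dv (r * φ) 1 v| := by
      have := abs_add_le (dv (r * φ) u v - dv (r * φ) 1 v) (dv (r * φ) 1 v)
      rwa [sub_add_cancel] at this
    have hB1 : 0 ≤ B * (1 / (2 * Λ)) := by positivity
    rcases le_total v₁ v with hle | hle
    · have h1 := h.dvrphi_sub_le le_rfl hu huv fun x hx => hb x v hx.1.le (hx.2.trans huv) hv
      have h2 := hv₁ v hle u hu huv.le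
      have h4 : B * (dv r 1 v - dv r u v) ≤ B * (1 / (2 * Λ)) := by
        gcongr; linarith
      linarith
    · have h1 := h.dvrphi_sub_le le_rfl hu huv fun x hx =>
        (hC' x v hx.1.le (hx.2.trans huv) hle).trans (le_max_left C' 0)
      have h2 := h.dvr_pos hu huv.le
      rw [hl] at h1
      have h4 : C * (1 / 2 - dv r u v) ≤ C * (1 / 2) := by
        gcongr; linarith
      linarith
  have hφ : ∀ u v, 1 ≤ u → u < v → |φ u v| ≤ 2 * (Λ * (D + C / 2)) := by
    intro u v hu huv
    refine abs_le_of_absorb_domains h.exists_phi_bound (fun v₀ B hB hb u v hu huv hv => ?_) hu huv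
    have h1 := h.abs_phi_le hu huv (A := D + C / 2 + B * (1 / (2 * Λ))) (by positivity)
      (fun x hx => hΛ u x hu hx.1.le)
      fun x hx => hstep v₀ B hB hb u x hu hx.1 (hx.2.le.trans hv)
    have e : Λ * (D + C / 2 + B * (1 / (2 * Λ))) = Λ * (D + C / 2) + B / 2 := by
      field_simp
    rwa [e] at h1
  set B := 2 * (Λ * (D + C / 2)) with hB
  have hB0 : 0 < B := by positivity
  refine ⟨D + C / 2 + B * (1 / (2 * Λ)) + B, by positivity, fun u v hu huv => ⟨?_, ?_⟩⟩
  · have := hstep v B hB0.le (fun x y h1 h2 _ => hφ x y h1 h2) u v hu huv le_rfl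
    linarith
  · have := hφ u v hu huv
    have : 0 ≤ D + C / 2 + B * (1 / (2 * Λ)) := by positivity
    linarith

/-! ### Growth of -ν along outgoing lines -/

theorem exists_monotone_dominating {f : ℝ → ℝ} {s : Set ℝ} {u b δ : ℝ} (hs : Icc u b ⊆ s)
    (hδ : 0 ≤ δ) (hf : eVariationOn f s ≤ ENNReal.ofReal δ) :
    ∃ w : ℝ → ℝ, (∀ x ∈ Icc u b, 0 ≤ w x ∧ w x ≤ δ) ∧
      ∀ x y, u ≤ x → x ≤ y → y ≤ b → |f y - f x| ≤ w y - w x := by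
  have hle : ∀ x ≤ b, eVariationOn f (Icc u x) ≤ ENNReal.ofReal δ := fun x hx =>
    (eVariationOn.mono f ((Icc_subset_Icc_right hx).trans hs)).trans hf
  refine ⟨fun x => (eVariationOn f (Icc u x)).toReal, fun x hx =>
    ⟨ENNReal.toReal_nonneg, ENNReal.toReal_le_of_le_ofReal hδ (hle x hx.2)⟩,
    fun x y hux hxy hyb => ?_⟩
  have h1 := eVariationOn.Icc_add_Icc f (s := univ) hux hxy (mem_univ x)
  simp only [univ_inter] at h1
  have h2 : eVariationOn f (Icc x y) ≠ ⊤ :=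
    ne_top_of_le_ne_top ENNReal.ofReal_ne_top
      ((eVariationOn.mono f ((Icc_subset_Icc hux hyb).trans hs)).trans hf)
  have h3 : eVariationOn f (Icc u x) ≠ ⊤ :=
    ne_top_of_le_ne_top ENNReal.ofReal_ne_top (hle x (hxy.trans hyb))
  have h4 : |f y - f x| ≤ (eVariationOn f (Icc x y)).toReal := by
    refine abs_sub_le_of_eVariationOn ENNReal.toReal_nonneg ?_ (right_mem_Icc.2 hxy)
      (left_mem_Icc.2 hxy)
    rw [ENNReal.ofReal_toReal h2]
  simp only
  rw [← h1, ENNReal.toReal_add h3 h2]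
  linarith

/-- Near the axis, the growth of `-ν` is controlled by the oscillation of `∂_v (r φ) / λ`. -/
theorem IsBVSolution.neg_dur_sub_le_of_osc (h : IsBVSolution φ r m) (hu : 1 ≤ u) {b T : ℝ}
    (hub : u < b) (hT0 : 0 ≤ T) (hT : T ≤ 1 / 2) {w : ℝ → ℝ} (hw : MonotoneOn w (Icc u b))
    (hwT : ∀ x ∈ Icc u b, 0 ≤ w x ∧ w x ≤ T)
    (hosc : ∀ x y, u < x → x ≤ y → y ≤ b →
      |dv (r * φ) u y / dv r u y - dv (r * φ) u x / dv r u x| ≤ w y - w x)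
    {a : ℝ} (hua : u < a) (hab : a ≤ b) :
    -du r u b + du r u a ≤ -du r u b * T := by
  have hs : (Icc u b).OrdConnected := ordConnected_Icc
  have hu' : u ∈ Icc u b := left_mem_Icc.2 hub.le
  have hb' : b ∈ Icc u b := right_mem_Icc.2 hub.le
  have hl : ∀ x, u ≤ x → 0 < dv r u x := fun x hx => h.dvr_pos hu hx
  have hr : IsPrimitiveOn (fun v => r u v) (fun v => dv r u v) (Icc u b) :=
    (h.r_dv u hu).mono Icc_subset_Ici_self
  have hsub : ∀ {x y : ℝ}, x ∈ Icc u b → y ∈ Icc u b → uIcc x y ⊆ uIcc u b := fun hx hy => by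
    rw [uIcc_of_le hub.le]; exact hs.uIcc_subset hx hy
  have hint : ∀ {f : ℝ → ℝ}, IntervalIntegrable f volume u b →
      IsPrimitiveOn (fun x => ∫ y in u..x, f y) f (Icc u b) := fun {f} hf x hx y hy =>
    ⟨hf.mono_set (hsub hx hy), intervalIntegral.integral_interval_sub_left
      (hf.mono_set (hsub hu' hy)) (hf.mono_set (hsub hu' hx))⟩
  have hbdd : ∀ {f : ℝ → ℝ}, AEStronglyMeasurable f (volume.restrict (Ioc u b)) →
      (∀ x ∈ Ioc u b, |f x| ≤ T) →
      IntervalIntegrable (fun x => f x * dv r u x) volume u b := fun {f} hf hfT => by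
    rw [intervalIntegrable_iff_integrableOn_Ioc_of_le hub.le]
    have h1 := (hr u hu' b hb').1.1
    refine Integrable.bdd_mul (c := T) h1 hf ?_
    filter_upwards [ae_restrict_mem measurableSet_Ioc] with x hx
    exact hfT x hx
  have hrpos : ∀ x, u < x → 0 < r u x := fun x hx => h.r_pos hu hx
  have hru : r u u = 0 := h.r_axis hu
  -- the first average of `w`
  have hwi : IntervalIntegrable w volume u b := by
    apply MonotoneOn.intervalIntegrable
    rwa [uIcc_of_le hub.le]
  obtain ⟨W, hWu, hW⟩ : ∃ W : ℝ → ℝ, W u = 0 ∧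
      IsPrimitiveOn W (fun x => w x * dv r u x) (Icc u b) :=
    ⟨_, intervalIntegral.integral_same, hint (hbdd hwi.1.aestronglyMeasurable fun x hx => by
      have := hwT x (Ioc_subset_Icc_self hx)
      rw [abs_of_nonneg this.1]; exact this.2)⟩
  have hW0 : ∀ x ∈ Icc u b, 0 ≤ W x := fun x hx => by
    rw [← hWu]
    exact hW.le_of_nonneg hu' hx hx.1 fun y hy =>
      mul_nonneg (hwT y ⟨hy.1.le, hy.2.le.trans hx.2⟩).1 (hl y hy.1.le).le
  have hWT : ∀ x ∈ Icc u b, W x ≤ T * r u x := fun x hx => by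
    have := hW.abs_sub_le hr hu' hx hx.1 (C := T) fun y hy => by
      have h1 := hwT y ⟨hy.1.le, hy.2.le.trans hx.2⟩
      rw [abs_mul, abs_of_nonneg h1.1, abs_of_pos (hl y hy.1.le)]
      exact mul_le_mul_of_nonneg_right h1.2 (hl y hy.1.le).le
    simp only [hWu, hru, sub_zero] at this
    exact (le_abs_self _).trans this
  have hWc := hW.continuousOn_Icc hs hu' hb'
  have hrc := hr.continuousOn_Icc hs hu' hb'
  have hφc : ContinuousOn (fun x => W x / r u x) (Ioc u b) :=
    (hWc.mono Ioc_subset_Icc_self).div (hrc.mono Ioc_subset_Icc_self) fun x hx => (hrpos x hx.1).ne'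
  have hφ0 : ∀ x ∈ Ioc u b, 0 ≤ W x / r u x ∧ W x / r u x ≤ T := fun x hx =>
    ⟨div_nonneg (hW0 x (Ioc_subset_Icc_self hx)) (hrpos x hx.1).le, by
      rw [div_le_iff₀ (hrpos x hx.1)]; exact hWT x (Ioc_subset_Icc_self hx)⟩
  -- the second average
  obtain ⟨Z, hZu, hZ⟩ : ∃ Z : ℝ → ℝ, Z u = 0 ∧
      IsPrimitiveOn Z (fun x => W x / r u x * dv r u x) (Icc u b) :=
    ⟨_, intervalIntegral.integral_same, hint (hbdd
      (hφc.aestronglyMeasurable measurableSet_Ioc) fun x hx => by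
        have := hφ0 x hx
        rw [abs_of_nonneg this.1]; exact this.2)⟩
  have hZ0 : ∀ x ∈ Icc u b, 0 ≤ Z x := fun x hx => by
    rw [← hZu]
    exact hZ.le_of_nonneg hu' hx hx.1 fun y hy =>
      mul_nonneg (hφ0 y ⟨hy.1, hy.2.le.trans hx.2⟩).1 (hl y hy.1.le).le
  have hZT : ∀ x ∈ Icc u b, Z x ≤ T * r u x := fun x hx => by
    have := hZ.abs_sub_le hr hu' hx hx.1 (C := T) fun y hy => by
      have h1 := hφ0 y ⟨hy.1, hy.2.le.trans hx.2⟩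
      rw [abs_mul, abs_of_nonneg h1.1, abs_of_pos (hl y hy.1.le)]
      exact mul_le_mul_of_nonneg_right h1.2 (hl y hy.1.le).le
    simp only [hZu, hru, sub_zero] at this
    exact (le_abs_self _).trans this
  -- φ is the average of g = ∂_v(rφ)/λ with weight λ, and W/r is the same average of w. Since w
  -- dominates the increments of g, it follows that |g - φ| ≤ w - W/r.
  have hosc' : ∀ x ∈ Ioc u b, |dv (r * φ) u x - dv r u x * φ u x|
      ≤ (w x - W x / r u x) * dv r u x := by
    intro x hx
    have hx' := Ioc_subset_Icc_self hx
    have hlx := hl x hx.1.le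
    have hrx := hrpos x hx.1
    set g := dv (r * φ) u x / dv r u x with hg
    have h1 := (((h.rphi_dv u hu).mono Icc_subset_Ici_self).sub_const_mul hr g).abs_sub_le
      (hW.sub_const_mul hr (w x)) (C := -1) hu' hx' hx.1.le fun y hy => by
        have hly := hl y hy.1.le
        have h2 := hosc y x hy.1 hy.2.le hx.2
        have e : dv (r * φ) u y - g * dv r u y
            = (dv (r * φ) u y / dv r u y - g) * dv r u y := by
          field_simp
        rw [e, abs_mul, abs_of_pos hly, abs_sub_comm]
        nlinarith
    simp only [Pi.mul_apply, hru, hWu, zero_mul, mul_zero, sub_zero] at h1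
    have e1 : r u x * φ u x - g * r u x = r u x * (φ u x - g) := by ring
    have e2 : -1 * (W x - w x * r u x) = r u x * (w x - W x / r u x) := by field_simp; ring
    rw [e1, e2, abs_mul, abs_of_pos hrx] at h1
    have h3 := le_of_mul_le_mul_left h1 hrx
    have e3 : dv (r * φ) u x - dv r u x * φ u x = (g - φ u x) * dv r u x := by
      rw [hg]; field_simp
    rw [e3, abs_mul, abs_of_pos hlx, abs_sub_comm]
    exact mul_le_mul_of_nonneg_right h3 hlx.le
  -- The cruder m ≤ T²r/2 would leave the divergent integral of λ/r in the equation for ν. Only one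
  -- factor w - W/r of the square is bounded by T; the other integrates to W - Z.
  have hm : ∀ x ∈ Ioc u b, m u x ≤ T / 2 * (W x - Z x) := by
    intro x hx
    have hx' := Ioc_subset_Icc_self hx
    have h1 := ((h.eq_dm_v u hu).mono (t := Icc u b) Icc_subset_Ici_self).sub_le_of_le hu' hx' hx.1.le
      (((hW.sub_const_mul hZ 1) u hu' x hx').1.const_mul (T / 2)) fun y hy => by
        have hy' : y ∈ Ioc u b := ⟨hy.1, hy.2.le.trans hx.2⟩
        refine (h.dm_v_le hu hy.1).trans ?_
        have hly := hl y hy.1.le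
        rw [div_le_iff₀ (by positivity)]
        have h2 := hosc' y hy'
        have h3 := sq_le_sq' (neg_le_of_abs_le h2) (le_of_abs_le h2)
        refine h3.trans ?_
        have h4 : 0 ≤ w y - W y / r u y :=
          nonneg_of_mul_nonneg_left ((abs_nonneg _).trans h2) hly
        have h5 : w y - W y / r u y ≤ T := by
          linarith [(hwT y (Ioc_subset_Icc_self hy')).2, (hφ0 y hy').1]
        have h6 : (w y - W y / r u y) ^ 2 ≤ T * (w y - W y / r u y) := by
          rw [sq]; exact mul_le_mul_of_nonneg_right h5 h4
        calc ((w y - W y / r u y) * dv r u y) ^ 2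
            = (w y - W y / r u y) ^ 2 * dv r u y ^ 2 := by ring
          _ ≤ T * (w y - W y / r u y) * dv r u y ^ 2 := by gcongr
          _ = _ := by ring
    rw [intervalIntegral.integral_const_mul, ← ((hW.sub_const_mul hZ 1) u hu' x hx').2,
      h.m_axis u hu] at h1
    simp only [hWu, hZu] at h1
    linarith
  have ha' : a ∈ Icc u b := ⟨hua.le, hab⟩
  -- The point of Z: (W - Z)λ/r² is exactly the derivative of Z/r, which stays in [0, T]. So there
  -- is no logarithm at the axis, and the growth factor is at most 2T² ≤ T.
  have hI := hZ.integral_div hr hs ha' hb' hab (fun x hx => (hrpos x (hua.trans_le hx.1)).ne')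
    (fun x hx => by
      have hux := hua.trans hx.1
      have h1 : ContinuousAt (fun x => W x / r u x) x :=
        (hφc x ⟨hux, hx.2.le⟩).continuousAt (Ioc_mem_nhds hux hx.2)
      exact h1.continuousWithinAt.mul (h.dvr_rightCont u x hu hux.le))
    fun x hx => h.dvr_rightCont u x hu (hua.trans hx.1).le
  have hnub := h.dur_neg hu hub
  have h4 := (h.eq_dr_v u hu).le_sub_of_le hua hub hab (hI.1.const_mul (du r u b * (2 * T)))
    fun x hx => by
      have hux := hua.trans hx.1
      have hx' : x ∈ Ioc u b := ⟨hux, hx.2.le⟩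
      have hx'' := Ioc_subset_Icc_self hx'
      have hrx := hrpos x hux
      have hlx := hl x hux.le
      have hmx := hm x hx'
      have h2 : 4 * m u x ≤ r u x := by
        have h3 : T / 2 * (W x - Z x) ≤ T / 2 * (T * r u x) := by
          have := hWT x hx''
          have := hZ0 x hx''
          gcongr
          linarith
        have h5 : T * T * r u x ≤ 1 / 2 * (1 / 2) * r u x := by gcongr
        nlinarith
      have h5 := h.neg_potential_le hu hux le_rfl h2
      have h6 := h.dur_anti hu hux hx.2.le
      have h7 : 4 * m u x * dv r u x * (-du r u x) / r u x ^ 2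
          ≤ 4 * (T / 2 * (W x - Z x)) * dv r u x * (-du r u b) / r u x ^ 2 := by
        have := h.m_nonneg hu hux.le
        have : 0 ≤ T / 2 * (W x - Z x) := this.trans hmx
        have := h.dur_neg hu hux
        gcongr
        linarith
      have h8 : du r u b * (2 * T) * ((W x / r u x * dv r u x * r u x - Z x * dv r u x) / r u x ^ 2)
          = -(4 * (T / 2 * (W x - Z x)) * dv r u x * (-du r u b) / r u x ^ 2) := by
        field_simp
        ring
      rw [h8]
      linarith
  rw [intervalIntegral.integral_const_mul, hI.2] at h4
  have h5 : Z b / r u b ≤ T := by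
    rw [div_le_iff₀ (hrpos b hub)]; exact hZT b hb'
  have h6 : 0 ≤ Z a / r u a := div_nonneg (hZ0 a ha') (hrpos a hua).le
  have h7 : 2 * T * (Z b / r u b - Z a / r u a) ≤ 1 * T := by
    have h8 : 2 * T * (Z b / r u b - Z a / r u a) ≤ 2 * T * T := by gcongr; linarith
    nlinarith
  have h8 : -du r u b * (2 * T * (Z b / r u b - Z a / r u a)) ≤ -du r u b * (1 * T) := by
    gcongr; linarith
  linarith

/-- Scattering controls the variation of log λ, whereas the oscillation of ∂_v(rφ)/λ involves that
of 1/λ. -/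
theorem abs_inv_sub_inv_le {x y Λ : ℝ} (hx : 0 < x) (hy : 0 < y) (hxΛ : x⁻¹ ≤ Λ) (hyΛ : y⁻¹ ≤ Λ) :
    |y⁻¹ - x⁻¹| ≤ Λ * |Real.log y - Real.log x| := by
  have key : ∀ p q : ℝ, 0 < p → 0 < q → p⁻¹ ≤ Λ →
      p⁻¹ - q⁻¹ ≤ Λ * |Real.log p - Real.log q| := by
    intro p q hp hq hpΛ
    have h1 := Real.log_le_sub_one_of_pos (div_pos hp hq)
    rw [Real.log_div hp.ne' hq.ne'] at h1
    have h2 : p⁻¹ * (1 - p / q) = p⁻¹ - q⁻¹ := by field_simp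
    have h3 : 0 < p⁻¹ := by positivity
    calc p⁻¹ - q⁻¹ = p⁻¹ * (1 - p / q) := h2.symm
      _ ≤ p⁻¹ * |Real.log p - Real.log q| := by
        gcongr
        have := neg_le_abs (Real.log p - Real.log q)
        linarith
      _ ≤ _ := by gcongr
  rw [abs_le]
  have h1 := key y x hy hx hyΛ
  have h2 := key x y hx hy hxΛ
  rw [abs_sub_comm] at h2
  constructor <;> linarith

namespace IsLocallyBVScattering

/-- `-ν` is uniformly close to its value on the axis. -/
theorem eventually_neg_dur_sub_le (h : IsLocallyBVScattering φ r m)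
    (hf : IsAsymptoticallyFlatBV φ r ω) {ε : ℝ} (hε : 0 < ε) :
    ∀ᶠ u in atTop, ∀ v, u < v → -du r u v - dv r u u ≤ ε := by
  obtain ⟨Λ, hΛ1, hΛ, -⟩ := h.exists_lambda_lower hf
  obtain ⟨A, hA0, hA⟩ := h.exists_bound hf
  obtain ⟨R, hR, hα, hl⟩ := h.scattering
  have hΛ0 : 0 < Λ := by linarith
  set η := min (1 / 4) (ε / 2) with hη
  have hη0 : 0 < η := by positivity
  have hη1 : η ≤ 1 / 4 := min_le_left _ _
  have hη2 : η ≤ ε / 2 := min_le_right _ _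
  -- Chosen so that ∂_v(rφ)/λ oscillates by at most Λδ + AΛδ = η where r ≤ R. Likewise `N` is chosen
  -- so that 4N/R = η bounds the growth factor where r ≥ R. Each region contributes at most η ≤ ε/2,
  -- as -ν ≤ 1 follows from λ ≤ 1/2 and η ≤ 1/4.
  set δ := η / (Λ * (1 + A)) with hδ
  have hδ0 : 0 < δ := by positivity
  set N := η * R / 4 with hN
  have hN0 : 0 < N := by positivity
  filter_upwards [hα.eventually_le_const (u := ENNReal.ofReal δ) (by simpa using hδ0),
    hl.eventually_le_const (u := ENNReal.ofReal δ) (by simpa using hδ0),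
    h.exists_mass_le hN0, eventually_ge_atTop 1] with u hu1 hu2 hmu hu
  obtain ⟨b, hub, hb⟩ := h.exists_r_eq hu hR
  have hinc : Icc u b ⊆ {v | u ≤ v ∧ r u v ≤ R} := fun x hx =>
    ⟨hx.1, hb ▸ h.r_mono hu hx.1 hx.2⟩
  obtain ⟨w₁, hw₁, hw₁'⟩ := exists_monotone_dominating hinc hδ0.le hu1
  obtain ⟨w₂, hw₂, hw₂'⟩ := exists_monotone_dominating hinc hδ0.le hu2
  have hinv : ∀ x, u ≤ x → (dv r u x)⁻¹ ≤ Λ := fun x hx => by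
    have h1 := h.dvr_pos hu hx
    rw [inv_le_iff_one_le_mul₀ h1]
    exact hΛ u x hu hx
  have hz : dv r u u ≤ 1 / 2 := h.dvr_le_half hu le_rfl
  have hnear : ∀ v, u < v → v ≤ b → -du r u v - dv r u u ≤ -du r u v * η := by
    intro v huv hvb
    have h1 : ∀ a, u < a → a ≤ v → -du r u v + du r u a ≤ -du r u v * η := by
      intro a hua hav
      refine h.neg_dur_sub_le_of_osc hu huv hη0.le (by linarith)
        (w := fun x => Λ * w₁ x + A * Λ * w₂ x) ?_ ?_ ?_ hua hav
      · intro x hx y hy hxy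
        have h1 := (abs_nonneg _).trans (hw₁' x y hx.1 hxy (hy.2.trans hvb))
        have h2 := (abs_nonneg _).trans (hw₂' x y hx.1 hxy (hy.2.trans hvb))
        have h3 : w₁ x ≤ w₁ y := by linarith
        have h4 : w₂ x ≤ w₂ y := by linarith
        simp only
        gcongr
      · intro x hx
        obtain ⟨h1, h2⟩ := hw₁ x ⟨hx.1, hx.2.trans hvb⟩
        obtain ⟨h3, h4⟩ := hw₂ x ⟨hx.1, hx.2.trans hvb⟩
        refine ⟨by positivity, ?_⟩
        calc Λ * w₁ x + A * Λ * w₂ x ≤ Λ * δ + A * Λ * δ := by gcongr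
          _ = η := by rw [hδ]; field_simp
      · intro x y hux hxy hyv
        have hlx := h.dvr_pos hu hux.le
        have hly := h.dvr_pos hu (hux.le.trans hxy)
        have h1 := hw₁' x y hux.le hxy (hyv.trans hvb)
        have h2 := hw₂' x y hux.le hxy (hyv.trans hvb)
        have h3 := abs_inv_sub_inv_le hlx hly (hinv x hux.le) (hinv y (hux.le.trans hxy))
        have e : dv (r * φ) u y / dv r u y - dv (r * φ) u x / dv r u x
            = (dv (r * φ) u y - dv (r * φ) u x) * (dv r u y)⁻¹
              + dv (r * φ) u x * ((dv r u y)⁻¹ - (dv r u x)⁻¹) := by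
          field_simp; ring
        rw [e]
        refine (abs_add_le _ _).trans ?_
        rw [abs_mul, abs_mul, abs_of_pos (inv_pos.2 hly)]
        have h4 : |dv (r * φ) u y - dv (r * φ) u x| * (dv r u y)⁻¹ ≤ (w₁ y - w₁ x) * Λ :=
          mul_le_mul h1 (hinv y (hux.le.trans hxy)) (by positivity) ((abs_nonneg _).trans h1)
        have h5 : |dv (r * φ) u x| * |(dv r u y)⁻¹ - (dv r u x)⁻¹|
            ≤ A * (Λ * (w₂ y - w₂ x)) := by
          refine mul_le_mul (hA u x hu hux).1 (h3.trans ?_) (abs_nonneg _) hA0.le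
          exact mul_le_mul_of_nonneg_left h2 hΛ0.le
        linarith
    have h2 : Tendsto (fun a => -du r u v + du r u a) (𝓝[>] u)
        (𝓝 (-du r u v + -dv r u u)) := (h.tendsto_dur_axis hu).const_add _
    rw [sub_eq_add_neg]
    refine le_of_tendsto h2 ?_
    filter_upwards [Ioc_mem_nhdsGT huv] with a ha
    exact h1 a ha.1 ha.2
  intro v huv
  rcases le_total v b with hvb | hvb
  · have h1 := hnear v huv hvb
    have h2 := h.dur_neg hu huv
    have h3 : -du r u v * η ≤ -du r u v * (1 / 4) := by gcongr; linarith
    have h4 : -du r u v ≤ 1 := by linarith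
    have h5 : -du r u v * η ≤ 1 * η := by gcongr
    linarith
  · have h1 := hnear b hub le_rfl
    have hn2 := h.dur_neg hu hub
    have hn3 := h.dur_neg hu huv
    have h2 := h.neg_dur_sub_le hu hub hvb hN0.le (hmu v huv.le) (by
      rw [hb, hN]; nlinarith)
    have h3 : 4 * N * (1 / r u b - 1 / r u v) ≤ η := by
      have h4 : 0 < 1 / r u v := by have := h.r_pos hu huv; positivity
      calc 4 * N * (1 / r u b - 1 / r u v) ≤ 4 * N * (1 / r u b) := by gcongr; linarith
        _ = η := by rw [hb, hN]; field_simp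
    have h4 : -du r u v * (4 * N * (1 / r u b - 1 / r u v)) ≤ -du r u v * η := by
      gcongr; linarith
    have h5 : -du r u b * η ≤ -du r u b * (1 / 4) := by gcongr; linarith
    have h6 : -du r u v * η ≤ -du r u v * (1 / 4) := by gcongr; linarith
    have h7 : -du r u b ≤ 1 := by linarith
    have h8 : -du r u v ≤ 1 := by linarith
    have h9 : -du r u b * η ≤ 1 * η := by gcongr
    have h10 : -du r u v * η ≤ 1 * η := by gcongr
    linarith

theorem exists_neg_dur_le (h : IsLocallyBVScattering φ r m) (hf : IsAsymptoticallyFlatBV φ r ω) :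
    ∃ K > 0, ∀ u v, 1 ≤ u → u < v → -du r u v ≤ K := by
  obtain ⟨N, hN0, hN⟩ := hf.exists_mass_bound h.toIsBVSolution
  obtain ⟨U, hU⟩ := eventually_atTop.1 ((h.eventually_neg_dur_sub_le hf one_pos).and
    (eventually_ge_atTop 1))
  have hU1 := (hU U le_rfl).2
  obtain ⟨v₀, hv₀, hr₀⟩ := h.exists_le_r hU1 (8 * N)
  -- The extra 1 keeps the comparison point strictly off the axis when u = U = v₀.
  obtain ⟨C, hC⟩ := h.sup_neg_nu 1 (v₀ + 1) le_rfl (by linarith)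
  refine ⟨max 2 (2 * C), by positivity, fun u v hu huv => ?_⟩
  have hz : dv r u u ≤ 1 / 2 := h.dvr_le_half hu le_rfl
  rcases le_total U u with huU | huU
  · exact le_max_of_le_left (by linarith [(hU u huU).1 v huv])
  refine le_max_of_le_right ?_
  rcases le_total v (v₀ + 1) with hle | hle
  · have h1 := hC u v hu huv hle
    have h2 := h.dur_neg hu huv
    linarith
  · have hlt : u < v₀ + 1 := by linarith
    have hUv : U ≤ v₀ + 1 := by linarith
    have h1 := hC u (v₀ + 1) hu hlt le_rfl
    have h2 := h.dur_neg hu huv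
    have h3 := (hr₀ (v₀ + 1) (by linarith)).trans (h.r_anti hu huU hUv)
    have h4 := h.neg_dur_sub_le hu hlt hle hN0.le (hN u v hu huv.le) (by linarith)
    have h5 : 4 * N * (1 / r u (v₀ + 1) - 1 / r u v) ≤ 1 / 2 := by
      have h6 : 0 < 1 / r u v := by have := h.r_pos hu huv; positivity
      have h7 := h.r_pos hu hlt
      calc 4 * N * (1 / r u (v₀ + 1) - 1 / r u v) ≤ 4 * N * (1 / r u (v₀ + 1)) := by
            gcongr; linarith
        _ ≤ 1 / 2 := by
            rw [mul_one_div, div_le_iff₀ h7]; linarith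
    have h6 : -du r u v * (4 * N * (1 / r u (v₀ + 1) - 1 / r u v)) ≤ -du r u v * (1 / 2) := by
      gcongr; linarith
    linarith

end IsLocallyBVScattering

/-! ### Decay of φ and lower bounds for ∂_v(rφ) and -∂_u(rφ) -/

namespace IsLocallyBVScattering

/-- Far from the axis, `∂_v (r φ)` is close to its initial value. -/
theorem exists_exterior_bound (h : IsLocallyBVScattering φ r m)
    (hf : IsAsymptoticallyFlatBV φ r ω) (hω : ω < 3) :
    ∃ C : ℝ, 0 < C ∧ ∃ δ : ℝ, 0 < δ ∧ ∀ᶠ v : ℝ in atTop, ∀ B : ℝ, 0 ≤ B →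
      (∀ x, 1 ≤ x → x < v → |φ x v| ≤ B * (x ^ (1 - ω) * v⁻¹)) → ∀ u, 1 ≤ u → u ≤ v / 2 →
      |dv (r * φ) u v - dv (r * φ) 1 v| ≤ C * B * (v ^ (-δ) * v ^ (-ω)) := by
  obtain ⟨N, hN0, hN⟩ := hf.exists_mass_bound h.toIsBVSolution
  obtain ⟨Λ, hΛ1, -, hΛ⟩ := h.exists_lambda_lower hf
  obtain ⟨K, hK0, hK⟩ := h.exists_neg_dur_le hf
  have hω1 := hf.one_lt
  have hΛ0 : 0 < Λ := by linarith
  -- The integrand is of size x^(1-ω) v⁻³. As ω + δ ≤ 3 and x ≤ v, the power v^(ω+δ-3) may be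
  -- replaced by x^(ω+δ-3), leaving v^(-ω-δ) x^(δ-2). With δ ≤ 1/2 the last factor is at most
  -- x^(-3/2), which is integrable.
  set δ := min (1 / 2) (3 - ω) with hδ
  have hδ0 : 0 < δ := lt_min (by norm_num) (by linarith)
  have hδ1 : δ ≤ 1 / 2 := min_le_left _ _
  have hδ2 : δ ≤ 3 - ω := min_le_right _ _
  refine ⟨2 * (8 * N * K * Λ ^ 2), by positivity, δ, hδ0, ?_⟩
  filter_upwards [eventually_ge_atTop (8 * N * Λ), eventually_ge_atTop 2]
    with v hvN hv2 B hB hφ u hu huv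
  have hv1 : 1 ≤ v := by linarith
  have hv0 : 0 < v := by linarith
  have huv' : u < v := by linarith
  have hG : IsPrimitiveOn (fun x => x ^ ((-3 / 2 : ℝ) + 1) / ((-3 / 2 : ℝ) + 1))
      (fun x => x ^ (-3 / 2 : ℝ)) (Ico 1 v) :=
    (IsPrimitiveOn.rpow (by norm_num)).mono Ico_subset_Ici_self
  have h1 := (h.eq_dphi_u v hv1).abs_sub_le hG (a := 1) (b := u) ⟨le_rfl, by linarith⟩
    ⟨hu, huv'⟩ hu (C := 8 * N * K * Λ ^ 2 * B * (v ^ (-δ) * v ^ (-ω))) fun x hx => by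
      have hx1 : 1 ≤ x := hx.1.le
      have hx0 : 0 < x := by linarith
      have hxv : x < v := hx.2.trans huv'
      have hr : v / 2 ≤ Λ * r x v := by linarith [hΛ x v hx1 hxv.le, hx.2]
      have hr4 : 4 * N ≤ r x v := by
        refine le_of_mul_le_mul_left (a := Λ) ?_ hΛ0
        linarith
      have hrp := h.r_pos hx1 hxv
      have h2 := h.neg_potential_le hx1 hxv (hN x v hx1 hxv.le) hr4
      have h3 : 4 * N * dv r x v * (-du r x v) / r x v ^ 2 ≤ 8 * N * K * Λ ^ 2 / v ^ 2 := by
        have h4 := h.dvr_le_half hx1 hxv.le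
        have h5 := h.dvr_pos hx1 hxv.le
        have h6 := h.dur_neg hx1 hxv
        have h7 : (v / 2) ^ 2 ≤ (Λ * r x v) ^ 2 := by gcongr
        rw [div_le_div_iff₀ (by positivity) (by positivity)]
        calc 4 * N * dv r x v * (-du r x v) * v ^ 2
            ≤ 4 * N * (1 / 2) * K * v ^ 2 := by
              have := hK x v hx1 hxv
              gcongr
              linarith
          _ = 8 * N * K * (v / 2) ^ 2 := by ring
          _ ≤ 8 * N * K * (Λ * r x v) ^ 2 := by gcongr
          _ = _ := by ring
      have h8 : x ^ (1 - ω) * v ^ (-3 : ℝ) ≤ v ^ (-δ) * v ^ (-ω) * x ^ (-3 / 2 : ℝ) := by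
        have e1 : v ^ (-3 : ℝ) = v ^ (-δ) * v ^ (-ω) * v ^ (ω + δ - 3) := by
          rw [← Real.rpow_add hv0, ← Real.rpow_add hv0]; ring_nf
        have h9 : v ^ (ω + δ - 3) ≤ x ^ (ω + δ - 3) :=
          Real.rpow_le_rpow_of_nonpos hx0 hxv.le (by linarith)
        have h10 : x ^ (1 - ω) * x ^ (ω + δ - 3) ≤ x ^ (-3 / 2 : ℝ) := by
          rw [← Real.rpow_add hx0]
          exact Real.rpow_le_rpow_of_exponent_le hx1 (by linarith)
        calc x ^ (1 - ω) * v ^ (-3 : ℝ)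
            = v ^ (-δ) * v ^ (-ω) * (x ^ (1 - ω) * v ^ (ω + δ - 3)) := by rw [e1]; ring
          _ ≤ v ^ (-δ) * v ^ (-ω) * (x ^ (1 - ω) * x ^ (ω + δ - 3)) := by gcongr
          _ ≤ _ := by gcongr
      have e3 : v ^ (-3 : ℝ) = (v ^ 2)⁻¹ * v⁻¹ := by
        rw [Real.rpow_neg hv0.le, ← mul_inv]; norm_cast
      rw [abs_mul, abs_of_nonpos (h.potential_nonpos hx1 hxv)]
      calc -potential r m x v * |φ x v|
          ≤ 8 * N * K * Λ ^ 2 / v ^ 2 * (B * (x ^ (1 - ω) * v⁻¹)) :=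
            mul_le_mul (h2.trans h3) (hφ x hx1 hxv) (abs_nonneg _) (by positivity)
        _ = 8 * N * K * Λ ^ 2 * B * (x ^ (1 - ω) * v ^ (-3 : ℝ)) := by rw [e3]; ring
        _ ≤ 8 * N * K * Λ ^ 2 * B * (v ^ (-δ) * v ^ (-ω) * x ^ (-3 / 2 : ℝ)) := by gcongr
        _ = _ := by ring
  refine h1.trans ?_
  have h2 : u ^ ((-3 / 2 : ℝ) + 1) / ((-3 / 2 : ℝ) + 1) - 1 ^ ((-3 / 2 : ℝ) + 1) / ((-3 / 2 : ℝ) + 1)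
      ≤ 2 := by
    have h3 : 0 < u ^ ((-3 / 2 : ℝ) + 1) := by positivity
    rw [Real.one_rpow]
    norm_num at h3 ⊢
    linarith
  calc _ ≤ 8 * N * K * Λ ^ 2 * B * (v ^ (-δ) * v ^ (-ω)) * 2 := by
        apply mul_le_mul_of_nonneg_left h2
        positivity
    _ = _ := by ring

/-- `∂_v (r φ)` is close to its initial value on each incoming line far out. -/
theorem eventually_abs_dvrphi_sub_le (h : IsLocallyBVScattering φ r m)
    (hf : IsAsymptoticallyFlatBV φ r ω) (hω : ω < 3) {η : ℝ} (hη : 0 < η) :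
    ∀ᶠ v : ℝ in atTop, ∀ B : ℝ, 0 ≤ B →
      (∀ x, 1 ≤ x → x < v → |φ x v| ≤ B * (x ^ (1 - ω) * v⁻¹)) → ∀ u, 1 ≤ u → u < v →
      |dv (r * φ) u v - dv (r * φ) 1 v| ≤ η * B * v ^ (-ω) := by
  obtain ⟨C, hC0, δ, hδ0, hext⟩ := h.exists_exterior_bound hf hω
  have hω1 := hf.one_lt
  have h1 : ∀ᶠ v : ℝ in atTop, C * v ^ (-δ) < η / 2 := by
    have := (tendsto_rpow_neg_atTop hδ0).const_mul C
    rw [mul_zero] at this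
    exact this.eventually_lt_const (by positivity)
  filter_upwards [hext, h1, eventually_ge_atTop 2,
    h.eventually_half_sub_le hf (by positivity : 0 < η / 8)] with v hv hv1 hv2 hl B hB hφ u hu huv
  have hv0 : 0 < v := by linarith
  have hvω : 0 < v ^ (-ω) := by positivity
  have hfar : ∀ u, 1 ≤ u → u ≤ v / 2 →
      |dv (r * φ) u v - dv (r * φ) 1 v| ≤ η / 2 * B * v ^ (-ω) := fun u hu huv => by
    calc _ ≤ C * B * (v ^ (-δ) * v ^ (-ω)) := hv B hB hφ u hu huv
      _ = C * v ^ (-δ) * B * v ^ (-ω) := by ring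
      _ ≤ _ := by gcongr
  have hη2 : η / 2 * B * v ^ (-ω) ≤ η * B * v ^ (-ω) := by
    gcongr; linarith
  rcases le_total u (v / 2) with hle | hle
  · exact (hfar u hu hle).trans hη2
  have h2 := hfar (v / 2) (by linarith) le_rfl
  -- For x ≥ v/2 the decay of φ costs 2^(ω-1) ≤ 4. The drop of λ is at most η/8, so this part
  -- contributes η/2, and the part u ≤ v/2 the other η/2.
  have h3 := h.dvrphi_sub_le (by linarith : 1 ≤ v / 2) hle huv (B := 4 * B * v ^ (-ω))
    fun x hx => by
      have hx0 : 0 < x := by linarith [hx.1]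
      refine (hφ x (by linarith [hx.1]) (hx.2.trans huv)).trans ?_
      have h4 : x ^ (1 - ω) ≤ 4 * v ^ (1 - ω) := by
        calc x ^ (1 - ω) ≤ (v / 2) ^ (1 - ω) :=
              Real.rpow_le_rpow_of_nonpos (by positivity) hx.1.le (by linarith)
          _ = 2 ^ (ω - 1) * v ^ (1 - ω) := by
              rw [Real.div_rpow hv0.le zero_le_two, div_eq_mul_inv, ← Real.rpow_neg zero_le_two]
              ring_nf
          _ ≤ 2 ^ (2 : ℝ) * v ^ (1 - ω) := by
              gcongr
              · norm_num
              · linarith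
          _ = 4 * v ^ (1 - ω) := by norm_num
      have e : v ^ (-ω) = v ^ (1 - ω) * v⁻¹ := by
        rw [← Real.rpow_neg_one, ← Real.rpow_add hv0]; ring_nf
      calc B * (x ^ (1 - ω) * v⁻¹) ≤ B * (4 * v ^ (1 - ω) * v⁻¹) := by gcongr
        _ = _ := by rw [e]; ring
  have h5 : 4 * B * v ^ (-ω) * (dv r (v / 2) v - dv r u v) ≤ 4 * B * v ^ (-ω) * (η / 8) := by
    have h6 := hl u hu huv.le
    have h7 := h.dvr_le_half (by linarith : 1 ≤ v / 2) (by linarith : v / 2 ≤ v)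
    gcongr
    linarith
  have h8 := abs_sub_le (dv (r * φ) u v) (dv (r * φ) (v / 2) v) (dv (r * φ) 1 v)
  linarith

/-- The upper bound on the decay of `φ`. -/
theorem exists_phi_decay (h : IsLocallyBVScattering φ r m)
    (hf : IsAsymptoticallyFlatBV φ r ω) (hω : ω < 3) :
    ∃ B > 0, ∀ u v, 1 ≤ u → u < v → |φ u v| ≤ B * (u ^ (1 - ω) * v⁻¹) := by
  obtain ⟨Λ, hΛ1, -, hΛ⟩ := h.exists_lambda_lower hf
  obtain ⟨A, hA0, hA⟩ := h.exists_bound hf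
  obtain ⟨D, hD0, hD⟩ := hf.abs_dvrphi_one_le h.toIsBVSolution
  have hω1 := hf.one_lt
  have hΛ0 : 0 < Λ := by linarith
  have hω' : 0 < ω - 1 := by linarith
  set C := Λ * (1 + 1 / (ω - 1)) with hC
  have hC0 : 0 < C := by positivity
  obtain ⟨v₂, hv₂⟩ := eventually_atTop.1
    (h.eventually_abs_dvrphi_sub_le hf hω (by positivity : 0 < 1 / (2 * C)))
  set v₁ := max v₂ 1 with hv₁
  have hv₁1 : 1 ≤ v₁ := le_max_right _ _
  have hv₁0 : 0 < v₁ := by linarith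
  set K := C * (D + A * v₁ ^ ω) with hK
  have hK0 : 0 < K := by positivity
  have hequiv : ∀ {u v B : ℝ}, 1 ≤ u → u < v →
      (|u ^ (ω - 1) * v * φ u v| ≤ B ↔ |φ u v| ≤ B * (u ^ (1 - ω) * v⁻¹)) := by
    intro u v B hu huv
    have hu0 : 0 < u := by linarith
    have hv0 : 0 < v := by linarith
    have hp : 0 < u ^ (ω - 1) * v := by positivity
    have e : u ^ (1 - ω) * v⁻¹ = (u ^ (ω - 1) * v)⁻¹ := by
      rw [mul_inv, ← Real.rpow_neg hu0.le]; ring_nf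
    rw [e, abs_mul, abs_of_pos hp, ← div_eq_mul_inv, le_div_iff₀ hp, mul_comm]
  refine ⟨2 * K, by positivity, fun u v hu huv => (hequiv hu huv).1 ?_⟩
  -- The weighted field is finite on each domain because φ is bounded. Beyond `v₁` the deviation of
  -- ∂_v(rφ) from its data is B/(2C) · x^(-ω), and integrating it to φ costs C, which leaves B/2;
  -- below `v₁` the uniform bound A is at most A v₁^ω x^(-ω).
  refine abs_le_of_absorb_domains (f := fun u v => u ^ (ω - 1) * v * φ u v) (fun v₀ => ?_)
    (fun v₀ B hB hb u v hu huv hv => ?_) hu huv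
  · refine ⟨v₀ ^ (ω - 1) * v₀ * A, fun u v hu huv hv => ?_⟩
    have hu0 : 0 < u := by linarith
    have hv0 : 0 < v := by linarith
    have hv₀0 : 0 < v₀ := by linarith
    rw [abs_mul, abs_of_pos (by positivity)]
    have h1 : u ^ (ω - 1) ≤ v₀ ^ (ω - 1) :=
      Real.rpow_le_rpow hu0.le (by linarith) hω'.le
    exact mul_le_mul (mul_le_mul h1 hv hv0.le (by positivity)) (hA u v hu huv).2 (abs_nonneg _)
      (by positivity)
  · have key : ∀ x ∈ Ioo u v,
        |dv (r * φ) u x| ≤ (D + A * v₁ ^ ω + 1 / (2 * C) * B) * x ^ (-ω) := by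
      intro x hx
      have hx1 : 1 ≤ x := hu.trans hx.1.le
      have hx0 : 0 < x := by linarith
      have hxω : 0 < x ^ (-ω) := by positivity
      have h1 : 0 ≤ 1 / (2 * C) * B * x ^ (-ω) := by positivity
      have h2 : 0 ≤ D * x ^ (-ω) := by positivity
      have h3 : 0 ≤ A * v₁ ^ ω * x ^ (-ω) := by positivity
      rw [add_mul, add_mul]
      rcases le_total v₁ x with hle | hle
      · have h4 := hv₂ x ((le_max_left _ _).trans hle) B hB (fun y hy hyx =>
          (hequiv hy hyx).1 (hb y x hy hyx (hx.2.le.trans hv))) u hu hx.1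
        have h5 := hD x hx1
        have h6 := abs_add_le (dv (r * φ) u x - dv (r * φ) 1 x) (dv (r * φ) 1 x)
        rw [sub_add_cancel] at h6
        linarith
      · have h4 := (hA u x hu hx.1).1
        have h5 : A ≤ A * v₁ ^ ω * x ^ (-ω) := by
          rw [mul_assoc, Real.rpow_neg hx0.le, ← div_eq_mul_inv]
          refine le_mul_of_one_le_right hA0.le ?_
          rw [one_le_div (by positivity)]
          exact Real.rpow_le_rpow hx0.le hle (by linarith)
        linarith
    have h1 := h.abs_phi_le_rpow hu huv hω1 (by positivity) (hΛ u v hu huv.le) key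
    have e : Λ * (1 + 1 / (ω - 1)) * (D + A * v₁ ^ ω + 1 / (2 * C) * B) = K + B / 2 := by
      rw [← hC, hK]; field_simp
    rw [e] at h1
    exact (hequiv hu huv).2 h1

/-- The lower bound on the decay of `∂_v (r φ)`. -/
theorem eventually_le_dvrphi (h : IsLocallyBVScattering φ r m)
    (hf : IsAsymptoticallyFlatBV φ r ω) (hω : ω < 3) {L V : ℝ} (hL : 0 < L)
    (hdata : ∀ v : ℝ, V ≤ v → L ≤ r 1 v ^ ω * dv (r * φ) 1 v) :
    ∀ᶠ v in atTop, ∀ u, 1 ≤ u → u < v → L / 2 * v ^ (-ω) ≤ dv (r * φ) u v := by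
  obtain ⟨B, hB0, hB⟩ := h.exists_phi_decay hf hω
  have hω1 := hf.one_lt
  filter_upwards [h.eventually_abs_dvrphi_sub_le hf hω (by positivity : 0 < L / (2 * B)),
    eventually_ge_atTop V, eventually_ge_atTop 2] with v hv hvV hv2 u hu huv
  have hv0 : 0 < v := by linarith
  have h1 := hv B hB0.le (fun x hx hxv => hB x v hx hxv) u hu huv
  have e : L / (2 * B) * B = L / 2 := by field_simp
  rw [e] at h1
  have h2 : L * v ^ (-ω) ≤ dv (r * φ) 1 v := by
    have h3 := hdata v hvV
    have hr := h.r_one (by linarith : 1 ≤ v)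
    have hrp : 0 < r 1 v := h.r_pos le_rfl (by linarith)
    have h4 : r 1 v ^ ω ≤ v ^ ω := Real.rpow_le_rpow hrp.le (by linarith) (by linarith)
    have h5 : 0 < r 1 v ^ ω := by positivity
    have h6 : 0 < dv (r * φ) 1 v := pos_of_mul_pos_right (hL.trans_le h3) h5.le
    rw [Real.rpow_neg hv0.le, ← div_eq_mul_inv, div_le_iff₀ (by positivity)]
    nlinarith
  linarith [neg_le_of_abs_le h1]

theorem eventually_le_dvrphi_axis (h : IsLocallyBVScattering φ r m)
    (hf : IsAsymptoticallyFlatBV φ r ω) (hω : ω < 3) {L V : ℝ} (hL : 0 < L)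
    (hdata : ∀ v : ℝ, V ≤ v → L ≤ r 1 v ^ ω * dv (r * φ) 1 v) :
    ∀ᶠ u in atTop, L / 2 * u ^ (-ω) ≤ dv (r * φ) u u := by
  obtain ⟨v₁, hv₁⟩ := eventually_atTop.1 (h.eventually_le_dvrphi hf hω hL hdata)
  filter_upwards [eventually_ge_atTop v₁, eventually_ge_atTop 1] with u huv hu
  have h1 : Tendsto (fun v : ℝ => L / 2 * v ^ (-ω)) (𝓝[>] u) (𝓝 (L / 2 * u ^ (-ω))) :=
    ((Real.continuousAt_rpow_const u (-ω) (Or.inl (by linarith))).tendsto.const_mul _).mono_left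
      nhdsWithin_le_nhds
  refine le_of_tendsto_of_tendsto h1 (h.tendsto_dvrphi_axis hu) ?_
  filter_upwards [self_mem_nhdsWithin] with v hv
  exact hv₁ v (huv.trans (le_of_lt hv)) u hu hv

/-- The lower bound on the decay of `-∂_u (r φ)`. -/
theorem eventually_le_neg_durphi (h : IsLocallyBVScattering φ r m)
    (hf : IsAsymptoticallyFlatBV φ r ω) (hω : ω < 3) {L V : ℝ} (hL : 0 < L)
    (hdata : ∀ v : ℝ, V ≤ v → L ≤ r 1 v ^ ω * dv (r * φ) 1 v) :
    ∀ᶠ u in atTop, ∀ v, u < v → L / 4 * u ^ (-ω) ≤ -du (r * φ) u v := by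
  obtain ⟨B, hB0, hB⟩ := h.exists_phi_decay hf hω
  filter_upwards [h.eventually_le_dvrphi_axis hf hω hL hdata, eventually_ge_atTop 1,
    h.eventually_neg_dur_sub_le hf (by positivity : 0 < L / (4 * B))] with u hα hu hν v huv
  have hu0 : 0 < u := by linarith
  have h1 : ∀ a, u < a → a ≤ v →
      |du (r * φ) u v - du (r * φ) u a| ≤ B * u ^ (-ω) * (du r u a - du r u v) := by
    intro a hua hav
    refine h.durphi_sub_le hu hua hav fun x hx => ?_
    have hux := hua.trans hx.1
    refine (hB u x hu hux).trans (mul_le_mul_of_nonneg_left ?_ hB0.le)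
    have e : u ^ (-ω) = u ^ (1 - ω) * u⁻¹ := by
      rw [← Real.rpow_neg_one, ← Real.rpow_add hu0]; ring_nf
    rw [e]
    gcongr
  -- Passage to the axis a → u, where both ∂_u(rφ) and ν are minus their v-counterparts. The
  -- threshold L/(4B) for the growth of -ν then costs L/4 of the axis bound L/2.
  have h2 : |du (r * φ) u v - -dv (r * φ) u u| ≤ B * u ^ (-ω) * (-dv r u u - du r u v) := by
    refine le_of_tendsto_of_tendsto ((h.tendsto_durphi_axis hu).const_sub _).abs
      (((h.tendsto_dur_axis hu).sub_const _).const_mul _) ?_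
    filter_upwards [Ioc_mem_nhdsGT huv] with a ha
    exact h1 a ha.1 ha.2
  have h3 : B * u ^ (-ω) * (-dv r u u - du r u v) ≤ B * u ^ (-ω) * (L / (4 * B)) := by
    have := hν v huv
    gcongr
    linarith
  have e : B * u ^ (-ω) * (L / (4 * B)) = L / 4 * u ^ (-ω) := by field_simp
  have h4 := (abs_le.1 (h2.trans h3)).2
  rw [e] at h4
  linarith

end IsLocallyBVScattering

end SSESF

theorem theorem3p5 (φ r m : ℝ → ℝ → ℝ) (ω L V : ℝ) (hω₁ : 1 < ω) (hω₃ : ω < 3)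
    (hsol : SSESF.IsLocallyBVScattering φ r m)
    (hflat : SSESF.IsAsymptoticallyFlatBV φ r ω)
    (hL : 0 < L) (hV : 1 ≤ V)
    (hdata : ∀ v : ℝ, V ≤ v → L ≤ r 1 v ^ ω * SSESF.dv (r * φ) 1 v) :
    ∃ Lω : ℝ, 0 < Lω ∧ ∃ U : ℝ, 1 ≤ U ∧ ∀ u : ℝ, U ≤ u →
      (∀ v : ℝ, u < v →
        Lω * min (r u v ^ (-ω)) (u ^ (-ω)) ≤ SSESF.dv (r * φ) u v ∧
        Lω * u ^ (-ω) ≤ -SSESF.du (r * φ) u v) ∧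
      Lω * u ^ (-ω) ≤ SSESF.dv (r * φ) u u := by
  obtain ⟨Λ, hΛ1, -, hΛ⟩ := hsol.exists_lambda_lower hflat
  have hΛ0 : 0 < Λ := by linarith
  obtain ⟨v₁, hv₁⟩ := Filter.eventually_atTop.1 (hsol.eventually_le_dvrphi hflat hω₃ hL hdata)
  obtain ⟨U₀, hU₀⟩ := Filter.eventually_atTop.1
    ((hsol.eventually_le_dvrphi_axis hflat hω₃ hL hdata).and
      (hsol.eventually_le_neg_durphi hflat hω₃ hL hdata))
  have hΛω : 0 < (1 + Λ) ^ (-ω) := by positivity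
  have hc1 : (1 + Λ) ^ (-ω) ≤ 1 :=
    Real.rpow_le_one_of_one_le_of_nonpos (by linarith) (by linarith)
  set c := L / 4 * (1 + Λ) ^ (-ω) with hc
  have hc0 : 0 < c := by positivity
  have hcL : c ≤ L / 4 := mul_le_of_le_one_right (by positivity) hc1
  refine ⟨c, hc0, max 1 (max v₁ U₀), le_max_left _ _, fun u hu => ?_⟩
  have hu1 : 1 ≤ u := (le_max_left _ _).trans hu
  have hu2 : v₁ ≤ u := ((le_max_left _ _).trans (le_max_right _ _)).trans hu
  obtain ⟨h1, h2⟩ := hU₀ u (((le_max_right _ _).trans (le_max_right _ _)).trans hu)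
  have hu0 : 0 < u := by linarith
  have huω : 0 < u ^ (-ω) := by positivity
  refine ⟨fun v huv => ⟨?_, ?_⟩, ?_⟩
  · have hv0 : 0 < v := by linarith
    have hr := hsol.r_pos hu1 huv
    have h3 := hv₁ v (hu2.trans huv.le) u hu1 huv
    have h4 := hΛ u v hu1 huv.le
    -- Applied with x = max(u, r): v ≤ u + Λr ≤ (1 + Λ)x, which turns the decay in v into decay in u
    -- and r and explains the factor (1 + Λ)^(-ω) in `c`.
    have key : ∀ x : ℝ, 0 < x → u ≤ x → r u v ≤ x → c * x ^ (-ω) ≤ L / 2 * v ^ (-ω) := by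
      intro x hx hux hrx
      have h5 : v ≤ (1 + Λ) * x := by nlinarith
      have h6 : ((1 + Λ) * x) ^ (-ω) ≤ v ^ (-ω) :=
        Real.rpow_le_rpow_of_nonpos hv0 h5 (by linarith)
      rw [Real.mul_rpow (by positivity) hx.le] at h6
      have h7 : 0 < v ^ (-ω) := by positivity
      calc c * x ^ (-ω) = L / 4 * ((1 + Λ) ^ (-ω) * x ^ (-ω)) := by rw [hc]; ring
        _ ≤ L / 4 * v ^ (-ω) := by gcongr
        _ ≤ L / 2 * v ^ (-ω) := by gcongr; norm_num
    refine le_trans ?_ h3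
    rcases le_total u (r u v) with hle | hle
    · exact (mul_le_mul_of_nonneg_left (min_le_left _ _) hc0.le).trans (key _ hr hle le_rfl)
    · exact (mul_le_mul_of_nonneg_left (min_le_right _ _) hc0.le).trans (key _ hu0 le_rfl hle)
  · exact (mul_le_mul_of_nonneg_right hcL huω.le).trans (h2 v huv)
  · exact (mul_le_mul_of_nonneg_right (by linarith) huω.le).trans h1
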